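/- Notation. Let $|\uparrow\rangle,|\downarrow\rangle$ be the standard basis of $\mathbb C^2$, let $\sigma^X,\sigma^Y,\sigma^Z$ be the Pauli matrices, $\mathcal B=\{1,\sigma^X,\sigma^Y,\sigma^Z\}\subset M_2(\mathbb C)$, $S^U=\sigma^U/2$ for $U\in\{X,Y,Z\}$ and $\rho=1/2$. All matrix spaces carry the Hilbert–Schmidt inner product $\langle A,B\rangle=\operatorname{tr}(A^*B)$, with norm $\|\cdot\|_2$; $|A\rangle\langle B|$ denotes the map $X\mapsto \operatorname{tr}(B^*X)A$. Transfer operators. Let $\mathbb E:M_2(\mathbb C)\to M_2(\mathbb C)$ be the spin-1 AKLT transfer operator $$\mathbb E=|1\rangle\langle\rho|-\tfrac13\sum_{U=X,Y,Z}|\sigma^U\rangle\langle S^U|.$$ For $0\le k\le m$ let $\phi_k^{m}\in(\mathbb C^2)^{\otimes m}$ be the normalized symmetric vector with $k$ up spins (that is, $\binom mk^{-1/2}$ times the sum of all product basis vectors with exactly $k$ up spins). For $0\le k\le d$ put $$V_k^d=\sqrt{\tfrac{d-k}{d}}\,|\downarrow\rangle\langle\phi_k^{d-1}|+\sqrt{\tfrac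 kd}\,|\uparrow\rangle\langle\phi_{k-1}^{d-1}|,\qquad W_k^d=KV_k^d,\qquad K=|\uparrow\rangle\langle\downarrow|-|\downarrow\rangle\langle\uparrow|$$ (terms with coefficient $0$ are omitted), and for $n\ge 0$ define $\mathbb E_L^{(d,n)}:M_2(\mathbb C)\to M_2(\mathbb C)^{\otimes (d-1)}$ by $$\mathbb E_L^{(d,0)}(B)=\sum_{k=0}^d (W_k^d)^*BW_k^d,\qquad \mathbb E_L^{(d,n)}=(\mathbb E^{\otimes (d-1)})^n\circ\mathbb E_L^{(d,0)} .$$ Matching operators. For a set $T\subseteq[m]=\{1,\dots,m\}$ of sites, an $r$-matching of $T$ is a set $p$ of $r$ unordered pairs of elements of $T$ whose union has $2r$ elements. Put $\mathbf S_i\cdot\mathbf S_j=\sum_{U}S^U_iS^U_j$ and $$(M_r)_T=\sum_{p}\ \prod_{(i,j)\in p}\mathbf S_i\cdot\mathbf S_j ,$$ the sum being over all $r$-matchings $p$ of $T$; it acts as the identity outside $T$, and $M_r^{(m)}=(M_r)_{[m]}$, $M_0^{(m)}=1$. For $\alpha\in\mathbb C$ define in $M_2(\mathbb C)^{\otimes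 (d-1)}$ $$V^{(d-1)}_{\rho}(\alpha)=\sum_{r=0}^{\lfloor (d-1)/2\rfloor}\frac{\alpha^{2r}}{(2r+1)!!}\,M_r^{(d-1)},$$ $$V^{(d-1)}_{S^U}(\alpha)=-\sum_{r=0}^{\lfloor (d-2)/2\rfloor}\sum_{j=1}^{d-1}\frac{\alpha^{2r+1}}{(2r+3)!!}\,S^U_j\,(M_r)_{[d-1]\setminus\{j\}} .$$ Lemma. Let $d\ge 3$, $n\ge 0$ and $\alpha_n=2(-1/3)^n$. Then $$\mathbb E_L^{(d,n)}(A)=\frac{d+1}{2^{d-1}}\,V^{(d-1)}_{A/2}(\alpha_n)\qquad\text{for all }A\in\mathcal B .$$ The four operators $V^{(d-1)}_{A/2}(\alpha_n)$, $A\in\mathcal B$, are pairwise orthogonal for the Hilbert–Schmidt inner product, and the singular values of $\mathbb E_L^{(d,n)}$ (with respect to the Hilbert–Schmidt inner products, counted with multiplicity) are the four numbers $$\frac{d+1}{2^{d-1/2}}\,\bigl\|V^{(d-1)}_{A/2}(\alpha_n)\bigr\|_2,\qquad A\in\mathcal B .$$ -/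

import Mathlib

open scoped Matrix Nat Matrix.Norms.Frobenius

/-! ## Hilbert–Schmidt structure on matrices -/

/-- The Hilbert–Schmidt inner product `⟪A, B⟫ = tr (Aᴴ B)`. Its norm is the Frobenius norm
`‖A‖ = (∑ |A i j|²)^{1/2}`, i.e. the Schatten `2`-norm. -/
noncomputable instance hilbertSchmidt {m n : Type*} [Fintype m] [Fintype n] :
    InnerProductSpace ℂ (Matrix m n ℂ) where
  inner A B := (Aᴴ * B).trace
  norm_sq_eq_re_inner A := by
    have h : ‖A‖ ^ 2 = ∑ i, ∑ j, ‖A i j‖ ^ 2 := by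
      rw [Matrix.frobenius_norm_def, ← Real.sqrt_eq_rpow, Real.sq_sqrt (by positivity)]
      simp
    rw [h, Finset.sum_comm]
    simp only [Matrix.trace, Matrix.diag_apply, Matrix.mul_apply, Matrix.conjTranspose_apply,
      map_sum]
    refine Finset.sum_congr rfl fun i _ => Finset.sum_congr rfl fun j _ => ?_
    simp [Complex.sq_norm, Complex.normSq_apply]
  conj_inner_symm A B := by
    rw [starRingEnd_apply, ← Matrix.trace_conjTranspose, Matrix.conjTranspose_mul,
      Matrix.conjTranspose_conjTranspose]
  add_left A B C := by
    simp [Matrix.conjTranspose_add, Matrix.add_mul, Matrix.trace_add]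
  smul_left A B c := by
    simp [Matrix.conjTranspose_smul, Matrix.trace_smul]

namespace AKLT

/-- `M₂(ℂ)`. The basis vector `0` of `ℂ²` is `↑`, the basis vector `1` is `↓`. -/
abbrev M2 : Type := Matrix (Fin 2) (Fin 2) ℂ

/-- `M₂(ℂ)^{⊗ m}`, realised as the matrices on `(ℂ²)^{⊗ m}` in the product basis, which is indexed
by the spin configurations `Fin m → Fin 2`. -/
abbrev MT (m : ℕ) : Type := Matrix (Fin m → Fin 2) (Fin m → Fin 2) ℂ

/-- The rank-one map `|A⟩⟨B| : X ↦ tr (Bᴴ X) A`. -/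
noncomputable def ketbra (A B : M2) : M2 →ₗ[ℂ] M2 :=
  (innerₛₗ ℂ B).smulRight A

/-- The Pauli matrices `σ^X, σ^Y, σ^Z`. -/
def pauli : Fin 3 → M2 :=
  ![!![0, 1; 1, 0], !![0, -Complex.I; Complex.I, 0], !![1, 0; 0, -1]]

/-- The spin operators `S^U = σ^U / 2`. -/
noncomputable def spin (U : Fin 3) : M2 := (1 / 2 : ℂ) • pauli U

/-- The orthogonal basis `1, σ^X, σ^Y, σ^Z` of `M₂(ℂ)`; the label `none` stands for `1`. -/
def basisB : Option (Fin 3) → M2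
  | none => 1
  | some U => pauli U

/-! ## Transfer operators -/

/-- The elementary tensor `A₁ ⊗ ⋯ ⊗ A_m`. -/
def pureTensor {m : ℕ} (A : Fin m → M2) : MT m :=
  Matrix.of fun s t => ∏ i, A i (s i) (t i)

/-- `T^{⊗ m}` for a linear map `T` on `M₂(ℂ)`: the linear map that sends the matrix unit
`|s⟩⟨t| = ⨂ᵢ |sᵢ⟩⟨tᵢ|` to `⨂ᵢ T(|sᵢ⟩⟨tᵢ|)`. -/
noncomputable def tensorPower (T : M2 →ₗ[ℂ] M2) (m : ℕ) : MT m →ₗ[ℂ] MT m :=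
  ∑ s : Fin m → Fin 2, ∑ t : Fin m → Fin 2,
    (Matrix.entryLinearMap ℂ ℂ s t).smulRight
      (pureTensor fun i => T (Matrix.single (s i) (t i) 1))

/-- The spin-1 AKLT transfer operator `𝔼 = |1⟩⟨ρ| - (1/3) ∑_U |σ^U⟩⟨S^U|`, `ρ = 1/2`. -/
noncomputable def transferE : M2 →ₗ[ℂ] M2 :=
  ketbra 1 ((1 / 2 : ℂ) • 1) - (1 / 3 : ℂ) • ∑ U : Fin 3, ketbra (pauli U) (spin U)

/-- The normalised symmetric vector `φ_k^m ∈ (ℂ²)^{⊗ m}` with `k` up spins (zero if `k > m`). -/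
noncomputable def symVec (m k : ℕ) : (Fin m → Fin 2) → ℂ := fun s =>
  if (Finset.univ.filter fun i => s i = 0).card = k then ((1 / √(m.choose k : ℝ) : ℝ) : ℂ) else 0

/-- The singlet tensor `K = |↑⟩⟨↓| - |↓⟩⟨↑|`. -/
def singletK : M2 := !![0, 1; -1, 0]

/-- `V_k^d = √((d-k)/d) |↓⟩⟨φ_k^{d-1}| + √(k/d) |↑⟩⟨φ_{k-1}^{d-1}|`, for `0 ≤ k ≤ d`. For `k = 0`
and for `k = d` one of the two terms has coefficient `0`. -/
noncomputable def tensorV (d k : ℕ) : Matrix (Fin 2) (Fin (d - 1) → Fin 2) ℂ :=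
  ((√(((d : ℝ) - k) / d) : ℝ) : ℂ) • Matrix.vecMulVec (Pi.single 1 1) (star (symVec (d - 1) k)) +
  ((√((k : ℝ) / d) : ℝ) : ℂ) • Matrix.vecMulVec (Pi.single 0 1) (star (symVec (d - 1) (k - 1)))

/-- `W_k^d = K V_k^d`. -/
noncomputable def tensorW (d k : ℕ) : Matrix (Fin 2) (Fin (d - 1) → Fin 2) ℂ :=
  singletK * tensorV d k

/-- The undecorated transfer operator `𝔼_L^{(d,0)}(B) = ∑_{k=0}^d (W_k^d)ᴴ B W_k^d`. -/
noncomputable def transferL0 (d : ℕ) : M2 →ₗ[ℂ] MT (d - 1) where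
  toFun B := ∑ k ∈ Finset.range (d + 1), (tensorW d k)ᴴ * B * tensorW d k
  map_add' A B := by simp [Matrix.mul_add, Matrix.add_mul, Finset.sum_add_distrib]
  map_smul' c B := by simp [Finset.smul_sum]

/-- The decorated transfer operator `𝔼_L^{(d,n)} = (𝔼^{⊗ (d-1)})ⁿ ∘ 𝔼_L^{(d,0)}`. -/
noncomputable def transferL (d n : ℕ) : M2 →ₗ[ℂ] MT (d - 1) :=
  (tensorPower transferE (d - 1) ^ n) ∘ₗ transferL0 d

/-! ## Matchings and matching operators -/

/-- The operator `A_j` that acts as `A` on site `j` and as the identity on the other sites. -/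
def siteOp {m : ℕ} (j : Fin m) (A : M2) : MT m :=
  pureTensor (Function.update (fun _ => 1) j A)

theorem pureTensor_mul {m : ℕ} (A B : Fin m → M2) :
    pureTensor A * pureTensor B = pureTensor fun i => A i * B i := by
  ext s t
  simp only [pureTensor, Matrix.mul_apply, Matrix.of_apply, Finset.prod_univ_sum,
    Fintype.piFinset_univ, Finset.prod_mul_distrib]

theorem siteOp_commute {m : ℕ} {i j : Fin m} (h : i ≠ j) (A B : M2) :
    Commute (siteOp i A) (siteOp j B) := by
  unfold Commute SemiconjBy siteOp
  rw [pureTensor_mul, pureTensor_mul]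
  congr 1
  funext k
  by_cases hi : k = i
  · subst hi; simp [Function.update_of_ne h]
  · simp [Function.update_of_ne hi]

/-- `𝐒ᵢ · 𝐒ⱼ = ∑_U S^U_i S^U_j`, as a function of the unordered pair of sites. -/
noncomputable def heis {m : ℕ} : Sym2 (Fin m) → MT m :=
  Sym2.lift ⟨fun i j => ∑ U : Fin 3, siteOp i (spin U) * siteOp j (spin U), fun i j => by
    by_cases h : i = j
    · rw [h]
    · exact Finset.sum_congr rfl fun U _ => siteOp_commute h _ _⟩

/-- The set of `r`-matchings of a set `T ⊆ [m]` of sites: the collections `p` of `r` unordered pairs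
of elements of `T` such that `⋃ p` has `2r` elements. -/
def matchings {m : ℕ} (T : Finset (Fin m)) (r : ℕ) : Finset (Finset (Sym2 (Fin m))) :=
  T.sym2.powerset.filter fun p => p.card = r ∧ (p.biUnion Sym2.toFinset).card = 2 * r

theorem matchings_disjoint {m : ℕ} {T : Finset (Fin m)} {r : ℕ} {p : Finset (Sym2 (Fin m))}
    (hp : p ∈ matchings T r) {a b : Sym2 (Fin m)} (ha : a ∈ p) (hb : b ∈ p) (hab : a ≠ b) :
    Disjoint a.toFinset b.toFinset := by
  obtain ⟨-, h1, h2⟩ := Finset.mem_filter.1 hp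
  have hle : ∀ z : Sym2 (Fin m), z.toFinset.card ≤ 2 := fun z => by
    by_cases hz : z.IsDiag
    · rw [Sym2.card_toFinset_of_isDiag z hz]; omega
    · rw [Sym2.card_toFinset_of_not_isDiag z hz]
  have hb' : b ∈ p.erase a := Finset.mem_erase.2 ⟨hab.symm, hb⟩
  obtain ⟨q, hq⟩ : ∃ q, q = (p.erase a).erase b := ⟨_, rfl⟩
  have hpq : p = insert a (insert b q) := by
    rw [hq, Finset.insert_erase hb', Finset.insert_erase ha]
  have hc : q.card + 2 = r := by
    have e1 := Finset.card_erase_add_one ha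
    have e2 := Finset.card_erase_add_one hb'
    rw [← hq] at e2
    omega
  have h3 : (q.biUnion Sym2.toFinset).card ≤ q.card * 2 :=
    Finset.card_biUnion_le_card_mul _ _ _ fun z _ => hle z
  have h4 : p.biUnion Sym2.toFinset = (a.toFinset ∪ b.toFinset) ∪ q.biUnion Sym2.toFinset := by
    rw [hpq, Finset.biUnion_insert, Finset.biUnion_insert, Finset.union_assoc]
  have h5 := Finset.card_union_le (a.toFinset ∪ b.toFinset) (q.biUnion Sym2.toFinset)
  rw [← h4, h2] at h5
  have h6 := Finset.card_union_add_card_inter a.toFinset b.toFinset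
  have h7 := hle a
  have h8 := hle b
  rw [Finset.disjoint_iff_inter_eq_empty, ← Finset.card_eq_zero]
  omega

theorem heis_commute {m : ℕ} {a b : Sym2 (Fin m)} (h : Disjoint a.toFinset b.toFinset) :
    Commute (heis a) (heis b) := by
  induction a using Sym2.ind with | _ i j =>
  induction b using Sym2.ind with | _ k l =>
  have h1 : ∀ x ∈ s(i, j), ∀ y ∈ s(k, l), x ≠ y := fun x hx y hy hxy =>
    Finset.disjoint_left.1 h (Sym2.mem_toFinset.2 hx) (Sym2.mem_toFinset.2 (hxy ▸ hy))
  have hik := h1 i (by simp) k (by simp)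
  have hil := h1 i (by simp) l (by simp)
  have hjk := h1 j (by simp) k (by simp)
  have hjl := h1 j (by simp) l (by simp)
  change Commute (∑ U : Fin 3, siteOp i (spin U) * siteOp j (spin U))
    (∑ U : Fin 3, siteOp k (spin U) * siteOp l (spin U))
  refine Commute.sum_left _ _ _ fun U _ => Commute.sum_right _ _ _ fun W _ => ?_
  exact ((siteOp_commute hik _ _).mul_right (siteOp_commute hil _ _)).mul_left
    ((siteOp_commute hjk _ _).mul_right (siteOp_commute hjl _ _))

/-- The matching operator `M_r = ∑_p ∏_{(i,j) ∈ p} 𝐒ᵢ · 𝐒ⱼ`, where `p` runs through the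
`r`-matchings of the set `T ⊆ [m]` of sites; it acts as the identity on the sites outside `T`. For
`T = [m]` this is `M_r^{(m)}`; for `T = [m] ∖ {j}` it is `1 ⊗ (M_r^{(m-1)})_{[m]∖{j}}`. -/
noncomputable def matchingOp {m : ℕ} (T : Finset (Fin m)) (r : ℕ) : MT m :=
  ∑ p ∈ (matchings T r).attach, p.1.noncommProd heis fun _ ha _ hb hab =>
    heis_commute (matchings_disjoint p.2 ha hb hab)

/-- `V_ρ^{(m)}(α) = ∑_{r=0}^{⌊m/2⌋} α^{2r} / (2r+1)!! M_r^{(m)}`. -/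
noncomputable def Vrho (m : ℕ) (α : ℂ) : MT m :=
  ∑ r ∈ Finset.range (m / 2 + 1), (α ^ (2 * r) / ((2 * r + 1)‼ : ℂ)) • matchingOp Finset.univ r

/-- `V_{S^U}^{(m)}(α) =
- ∑_{r=0}^{⌊(m-1)/2⌋} ∑_{j=1}^m α^{2r+1} / (2r+3)!! S^U_j ⊗ (M_r^{(m-1)})_{[m]∖{j}}`. -/
noncomputable def Vspin (m : ℕ) (U : Fin 3) (α : ℂ) : MT m :=
  -∑ r ∈ Finset.range ((m - 1) / 2 + 1), ∑ j : Fin m,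
    (α ^ (2 * r + 1) / ((2 * r + 3)‼ : ℂ)) •
      (siteOp j (spin U) * matchingOp (Finset.univ.erase j) r)

/-- `V_{A/2}^{(m)}(α)` for the element `A` of the basis `1, σ^X, σ^Y, σ^Z` with the given label:
`1/2 = ρ` and `σ^U/2 = S^U`. -/
noncomputable def Vop (m : ℕ) : Option (Fin 3) → ℂ → MT m
  | none => Vrho m
  | some U => Vspin m U

end AKLT

namespace AKLT

/-! ## The recursion for the matching operators -/

section Matchings

variable {m : ℕ}

/-! The case `n = 0` is an entrywise computation in the product basis. Since `4 𝐒ᵢ·𝐒ⱼ` is twice the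
swap of the sites `i`, `j` minus `1`, the entry of `∑ᵣ 4ʳ/(2r+2q+1)!! (Mᵣ)_T` between configurations
`s` and `t` that agree outside `T` depends only on how many sites of `T` carry each pair `(s k, t
k)`. Sorting matchings by the partner of one site gives a recursion in `T` that raises `q`, and
`entry` is its closed solution (`matchingSum_apply`). For `q = 0` the nonzero entries are `2^N /
((N+1) (N choose u))`, with `N = |T|` and `u` the number of up spins of `s` in `T`.

On the other side, `V_k^d` is the symmetric state with `k` up spins on `d` sites with one site split
off, so the entries of `𝔼_L^{(d,0)}(B)` are entries of `B` times reciprocals of binomial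
coefficients of `d` (`transferL0_apply`). Elementary identities between such reciprocals match both
sides at `α = 2`, where `α^{2r} = 4ʳ` (`transferL0_one`, `transferL0_pauli`).

Decoration only changes `α`. `𝔼` fixes `1` and multiplies each Pauli matrix by `-1/3`, so its tensor
power scales a Pauli string with `k` nontrivial factors by `(-1/3)^k`. The term with `α^k` in each
`V` consists of strings with exactly `k` such factors, so `n` applications turn `2` into `2(-1/3)ⁿ`
(`pow_tensorPower_Vop`).

The four operators are orthogonal because the parities of the numbers of `σ^X, σ^Y, σ^Z` in their
strings differ (`inner_Vop`). As the matrices `A/√2` form an orthonormal basis of `M₂(ℂ)` with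
orthogonal images, the norms of these images are the singular values. -/

theorem card_toFinset_le_two (z : Sym2 (Fin m)) : z.toFinset.card ≤ 2 := by
  by_cases hz : z.IsDiag
  · rw [Sym2.card_toFinset_of_isDiag z hz]; omega
  · rw [Sym2.card_toFinset_of_not_isDiag z hz]

theorem card_biUnion_toFinset_le (p : Finset (Sym2 (Fin m))) :
    (p.biUnion Sym2.toFinset).card ≤ p.card * 2 :=
  Finset.card_biUnion_le_card_mul _ _ _ fun z _ => card_toFinset_le_two z

theorem mem_matchings {T : Finset (Fin m)} {r : ℕ} {p : Finset (Sym2 (Fin m))} :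
    p ∈ matchings T r ↔
      p ⊆ T.sym2 ∧ p.card = r ∧ (p.biUnion Sym2.toFinset).card = 2 * r := by
  simp [matchings]

/-- The union of `r + 1` pairs has at most `2(r + 1)` elements; equality forces the new pair to be
off-diagonal and to miss all sites already used. -/
theorem insert_mem_matchings {T : Finset (Fin m)} {r : ℕ} {q : Finset (Sym2 (Fin m))}
    {i j : Fin m} (hz : s(i, j) ∉ q) :
    insert s(i, j) q ∈ matchings T (r + 1) ↔
      q ∈ matchings T r ∧ i ∈ T ∧ j ∈ T ∧ i ≠ j ∧
        i ∉ q.biUnion Sym2.toFinset ∧ j ∉ q.biUnion Sym2.toFinset := by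
  have e : s(i, j).toFinset = {i, j} := by ext; simp
  rw [mem_matchings, mem_matchings, Finset.insert_subset_iff, Finset.card_insert_of_notMem hz,
    Finset.biUnion_insert, e, Finset.mk_mem_sym2_iff]
  have h1 := card_biUnion_toFinset_le q
  generalize hU : q.biUnion Sym2.toFinset = U at *
  have h2 : ({i, j} : Finset (Fin m)).card ≤ 2 := Finset.card_le_two
  have h3 := Finset.card_union_add_card_inter {i, j} U
  constructor
  · rintro ⟨⟨⟨hi, hj⟩, hq⟩, hc, hu⟩
    have h4 : ({i, j} ∩ U).card = 0 := by omega
    have h5 : ({i, j} : Finset (Fin m)).card = 2 := by omega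
    have h6 : i ≠ j := by
      rintro rfl
      simp at h5
    rw [Finset.card_eq_zero, ← Finset.disjoint_iff_inter_eq_empty] at h4
    rw [Finset.disjoint_left] at h4
    exact ⟨⟨hq, by omega, by omega⟩, hi, hj, h6, h4 (by simp), h4 (by simp)⟩
  · rintro ⟨⟨hq, hc, hu⟩, hi, hj, hij, hiU, hjU⟩
    have h4 : {i, j} ∩ U = ∅ := by
      rw [← Finset.disjoint_iff_inter_eq_empty, Finset.disjoint_left]
      simp only [Finset.mem_insert, Finset.mem_singleton]
      rintro x (rfl | rfl) <;> assumption
    have h5 := Finset.card_pair hij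
    rw [h4, Finset.card_empty] at h3
    exact ⟨⟨⟨hi, hj⟩, hq⟩, by omega, by omega⟩

theorem biUnion_subset_of_mem_matchings {T : Finset (Fin m)} {r : ℕ}
    {p : Finset (Sym2 (Fin m))} (hp : p ∈ matchings T r) : p.biUnion Sym2.toFinset ⊆ T := by
  intro x hx
  obtain ⟨z, hz, hxz⟩ := Finset.mem_biUnion.1 hx
  exact Finset.mem_sym2_iff.1 ((mem_matchings.1 hp).1 hz) x (Sym2.mem_toFinset.1 hxz)

theorem mem_matchings_congr {S T : Finset (Fin m)} {r : ℕ} {p : Finset (Sym2 (Fin m))}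
    (hp : p ∈ matchings S r) (h : p.biUnion Sym2.toFinset ⊆ T) : p ∈ matchings T r := by
  rw [mem_matchings] at hp ⊢
  refine ⟨fun z hz => Finset.mem_sym2_iff.2 fun x hx => h ?_, hp.2⟩
  exact Finset.mem_biUnion.2 ⟨z, hz, Sym2.mem_toFinset.2 hx⟩

/-- Either `j` is unmatched, or it has a partner `i`; removing the pair then leaves a matching that
avoids both. -/
theorem matchings_insert {T : Finset (Fin m)} {j : Fin m} (hj : j ∉ T) (r : ℕ) :
    matchings (insert j T) (r + 1) = matchings T (r + 1) ∪
      T.biUnion fun i => (matchings (T.erase i) r).image (insert s(i, j)) := by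
  ext p
  simp only [Finset.mem_union, Finset.mem_biUnion, Finset.mem_image]
  constructor
  · intro hp
    have hsub := biUnion_subset_of_mem_matchings hp
    by_cases hjp : j ∈ p.biUnion Sym2.toFinset
    · right
      obtain ⟨z, hz, hjz⟩ := Finset.mem_biUnion.1 hjp
      obtain ⟨i, rfl⟩ := Sym2.mem_iff_exists.1 (Sym2.mem_toFinset.1 hjz)
      rw [Sym2.eq_swap] at hz
      rw [← Finset.insert_erase hz,
        insert_mem_matchings (Finset.notMem_erase _ _)] at hp
      obtain ⟨hq, hi, -, hij, hiU, hjU⟩ := hp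
      refine ⟨i, Finset.mem_of_mem_insert_of_ne hi hij, _, mem_matchings_congr hq ?_,
        Finset.insert_erase hz⟩
      intro x hx
      have hx' := biUnion_subset_of_mem_matchings hq hx
      refine Finset.mem_erase.2 ⟨?_, Finset.mem_of_mem_insert_of_ne hx' ?_⟩
      · rintro rfl; exact hiU hx
      · rintro rfl; exact hjU hx
    · left
      refine mem_matchings_congr hp fun x hx => Finset.mem_of_mem_insert_of_ne (hsub hx) ?_
      rintro rfl; exact hjp hx
  · rintro (hp | ⟨i, hi, q, hq, rfl⟩)
    · exact mem_matchings_congr hp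
        ((biUnion_subset_of_mem_matchings hp).trans (Finset.subset_insert _ _))
    · have hsub := biUnion_subset_of_mem_matchings hq
      have hjq : j ∉ q.biUnion Sym2.toFinset := fun h => hj (Finset.mem_of_mem_erase (hsub h))
      have hz : s(i, j) ∉ q := fun h =>
        hjq (Finset.mem_biUnion.2 ⟨_, h, by simp⟩)
      rw [insert_mem_matchings hz]
      refine ⟨mem_matchings_congr hq (hsub.trans
        ((Finset.erase_subset _ _).trans (Finset.subset_insert _ _))),
        Finset.mem_insert_of_mem hi, Finset.mem_insert_self _ _, ?_, ?_, hjq⟩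
      · rintro rfl; exact hj hi
      · exact fun h => Finset.notMem_erase _ _ (hsub h)

open Classical in
/-- The product of the `𝐒ᵢ · 𝐒ⱼ` over the pairs in `p` (zero unless the factors commute). -/
noncomputable def heisProd (p : Finset (Sym2 (Fin m))) : MT m :=
  if h : (p : Set (Sym2 (Fin m))).Pairwise (Function.onFun Commute heis) then
    p.noncommProd heis h else 0

theorem matchingOp_eq_sum (T : Finset (Fin m)) (r : ℕ) :
    matchingOp T r = ∑ p ∈ matchings T r, heisProd p := by
  rw [matchingOp, ← Finset.sum_attach (matchings T r)]
  refine Finset.sum_congr rfl fun p _ => ?_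
  exact (dif_pos fun a ha b hb hab => heis_commute (matchings_disjoint p.2 ha hb hab)).symm

theorem heisProd_insert {p : Finset (Sym2 (Fin m))} {z : Sym2 (Fin m)} (hz : z ∉ p)
    (h : (↑(insert z p) : Set (Sym2 (Fin m))).Pairwise (Function.onFun Commute heis)) :
    heisProd (insert z p) = heis z * heisProd p := by
  rw [heisProd, dif_pos h, heisProd, dif_pos (h.mono (by simp)),
    Finset.noncommProd_insert_of_notMem _ _ _ _ hz]

theorem matchingOp_zero (T : Finset (Fin m)) : matchingOp T 0 = 1 := by
  have h : matchings T 0 = {∅} := by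
    ext p
    rw [mem_matchings, Finset.mem_singleton]
    constructor
    · rintro ⟨-, h, -⟩
      exact Finset.card_eq_zero.1 h
    · rintro rfl
      simp
  rw [matchingOp_eq_sum, h, Finset.sum_singleton, heisProd, dif_pos (by simp)]
  simp

theorem matchingOp_empty_succ (r : ℕ) : matchingOp (∅ : Finset (Fin m)) (r + 1) = 0 := by
  rw [matchingOp_eq_sum]
  refine Finset.sum_eq_zero fun p hp => ?_
  have h := biUnion_subset_of_mem_matchings hp
  rw [Finset.subset_empty] at h
  have := (mem_matchings.1 hp).2.2
  rw [h] at this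
  simp at this

theorem matchingOp_insert {T : Finset (Fin m)} {j : Fin m} (hj : j ∉ T) (r : ℕ) :
    matchingOp (insert j T) (r + 1) = matchingOp T (r + 1) +
      ∑ i ∈ T, heis s(i, j) * matchingOp (T.erase i) r := by
  -- As the reduced matching never touches `j`, the inserted pair can be recovered: insertion is
  -- injective, and different partners give disjoint images.
  have key : ∀ i ∈ T, ∀ q ∈ matchings (T.erase i) r, j ∉ q.biUnion Sym2.toFinset :=
    fun i _ q hq h =>
      hj (Finset.mem_of_mem_erase (biUnion_subset_of_mem_matchings hq h))
  have key' : ∀ i ∈ T, ∀ q ∈ matchings (T.erase i) r, ∀ k, s(k, j) ∉ q :=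
    fun i hi q hq k h => key i hi q hq (Finset.mem_biUnion.2 ⟨_, h, by simp⟩)
  rw [matchingOp_eq_sum, matchings_insert hj, Finset.sum_union, ← matchingOp_eq_sum,
    Finset.sum_biUnion]
  · congr 1
    refine Finset.sum_congr rfl fun i hi => ?_
    rw [Finset.sum_image, matchingOp_eq_sum, Finset.mul_sum]
    · refine Finset.sum_congr rfl fun q hq => heisProd_insert (key' i hi q hq i) ?_
      have hp : insert s(i, j) q ∈ matchings (insert j T) (r + 1) := by
        rw [matchings_insert hj]
        exact Finset.mem_union_right _ (Finset.mem_biUnion.2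
          ⟨i, hi, Finset.mem_image_of_mem _ hq⟩)
      exact fun a ha b hb hab => heis_commute (matchings_disjoint hp ha hb hab)
    · intro q hq q' hq' h
      rw [← Finset.erase_insert (key' i hi q hq i), ← Finset.erase_insert (key' i hi q' hq' i), h]
  · intro i hi i' hi' hne
    rw [Function.onFun, Finset.disjoint_left]
    intro p hp hp'
    obtain ⟨q, hq, rfl⟩ := Finset.mem_image.1 hp
    obtain ⟨q', hq', h⟩ := Finset.mem_image.1 hp'
    have : s(i, j) ∈ insert s(i', j) q' := h ▸ Finset.mem_insert_self _ _
    rcases Finset.mem_insert.1 this with h1 | h1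
    · exact hne (Sym2.congr_left.1 h1)
    · exact key' i' hi' q' hq' i h1
  · rw [Finset.disjoint_left]
    intro p hp hp'
    obtain ⟨i, hi, hp'⟩ := Finset.mem_biUnion.1 hp'
    obtain ⟨q, hq, rfl⟩ := Finset.mem_image.1 hp'
    exact hj (biUnion_subset_of_mem_matchings hp
      (Finset.mem_biUnion.2 ⟨s(i, j), Finset.mem_insert_self _ _, by simp⟩))

end Matchings

/-! ## Matrix entries of the weighted sums of matching operators -/

section Entries

variable {m : ℕ}

theorem siteOp_apply (j : Fin m) (A : M2) (s t : Fin m → Fin 2) :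
    siteOp j A s t = if ∀ k, k ≠ j → s k = t k then A (s j) (t j) else 0 := by
  rw [siteOp, pureTensor, Matrix.of_apply, ← Finset.mul_prod_erase _ _ (Finset.mem_univ j),
    Function.update_self]
  have h : ∀ k ∈ Finset.univ.erase j,
      Function.update (fun _ => (1 : M2)) j A k (s k) (t k) = if s k = t k then 1 else 0 := by
    intro k hk
    rw [Function.update_of_ne (Finset.ne_of_mem_erase hk), Matrix.one_apply]
  rw [Finset.prod_congr rfl h, Finset.prod_boole]
  simp

theorem siteOp_mul_apply (j : Fin m) (A : M2) (X : MT m) (s t : Fin m → Fin 2) :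
    (siteOp j A * X) s t = ∑ a, A (s j) a * X (Function.update s j a) t := by
  rw [Matrix.mul_apply]
  symm
  refine Fintype.sum_of_injective (fun a => Function.update s j a)
    (Function.update_injective s j) _ _ ?_ ?_
  · intro u hu
    rw [siteOp_apply, if_neg, zero_mul]
    intro h
    refine hu ⟨u j, ?_⟩
    ext k
    by_cases hk : k = j
    · subst hk; simp
    · simp [hk, h k hk]
  · intro a
    rw [siteOp_apply, if_pos, Function.update_self]
    intro k hk
    rw [Function.update_of_ne hk]

/-- This is the identity `4 𝐒ᵢ·𝐒ⱼ = 2 · swap - 1` on two spins, read off on rows. -/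
theorem heis_mul_apply {i j : Fin m} (hij : i ≠ j) (X : MT m) (s t : Fin m → Fin 2) :
    4 * (heis s(i, j) * X) s t = 2 * X (s ∘ Equiv.swap i j) t - X s t := by
  have h : ∀ U, (siteOp i (spin U) * siteOp j (spin U) * X) s t =
      ∑ a, spin U (s i) a * ∑ b, spin U (s j) b *
        X (Function.update (Function.update s i a) j b) t := by
    intro U
    rw [Matrix.mul_assoc, siteOp_mul_apply]
    refine Finset.sum_congr rfl fun a _ => ?_
    rw [siteOp_mul_apply, Function.update_of_ne hij.symm]
  have hs : s ∘ Equiv.swap i j = Function.update (Function.update s i (s j)) j (s i) := by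
    ext k
    by_cases hk : k = j
    · subst hk; simp
    · by_cases hk' : k = i
      · subst hk'; simp [hk]
      · simp [hk, hk', Equiv.swap_apply_of_ne_of_ne hk' hk]
  have hs' : s = Function.update (Function.update s i (s i)) j (s j) := by simp
  change 4 * ((∑ U : Fin 3, siteOp i (spin U) * siteOp j (spin U)) * X) s t = _
  rw [Finset.sum_mul, Matrix.sum_apply, Finset.sum_congr rfl fun U _ => h U, hs]
  conv_rhs => rw [show X s t = X (Function.update (Function.update s i (s i)) j (s j)) t by
    rw [← hs']]
  generalize hY : (fun a b => X (Function.update (Function.update s i a) j b) t) = Y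
  have hY' : ∀ a b, X (Function.update (Function.update s i a) j b) t = Y a b :=
    fun a b => by rw [← hY]
  simp only [hY']
  generalize s i = x
  generalize s j = y
  fin_cases x <;> fin_cases y <;>
    simp [Fin.sum_univ_succ, spin, pauli] <;> ring_nf <;> simp <;> ring

/-- The number of sites `k ∈ T` with `s k = x` and `t k = y`. -/
def cnt (T : Finset (Fin m)) (s t : Fin m → Fin 2) (x y : Fin 2) : ℕ :=
  (T.filter fun k => s k = x ∧ t k = y).card

theorem cnt_insert {T : Finset (Fin m)} {j : Fin m} (hj : j ∉ T) (s t : Fin m → Fin 2)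
    (x y : Fin 2) :
    cnt (insert j T) s t x y = cnt T s t x y + if s j = x ∧ t j = y then 1 else 0 := by
  rw [cnt, cnt, Finset.filter_insert]
  split_ifs with h
  · rw [Finset.card_insert_of_notMem (by simp [hj])]
  · rfl

theorem cnt_erase {T : Finset (Fin m)} {i : Fin m} (hi : i ∈ T) (s t : Fin m → Fin 2)
    (x y : Fin 2) :
    cnt (T.erase i) s t x y = cnt T s t x y - if s i = x ∧ t i = y then 1 else 0 := by
  conv_rhs => rw [← Finset.insert_erase hi]
  rw [cnt_insert (Finset.notMem_erase _ _), Nat.add_sub_cancel]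

theorem cnt_congr {T : Finset (Fin m)} {s s' t : Fin m → Fin 2} (h : ∀ k ∈ T, s k = s' k)
    (x y : Fin 2) : cnt T s t x y = cnt T s' t x y := by
  rw [cnt, cnt, Finset.filter_congr fun k hk => by rw [h k hk]]

theorem sum_ite_cnt (T : Finset (Fin m)) (s t : Fin m → Fin 2) (x y : Fin 2) (z : ℂ) :
    ∑ k ∈ T, (if s k = x ∧ t k = y then z else 0) = cnt T s t x y * z := by
  rw [← Finset.sum_filter, Finset.sum_const, cnt, nsmul_eq_mul]

/-- The entry of `∑ᵣ 4ʳ / (2r+2q+1)!! Mᵣ` between two configurations with `a` sites `(↑, ↑)`,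
`b` sites `(↓, ↓)`, `c` sites `(↑, ↓)` and `e` sites `(↓, ↑)`. -/
noncomputable def entry (q a b c e : ℕ) : ℂ :=
  if c = e then 2 ^ (q + (a + b + 2 * c)) * c ! * (a + c + q)! * (b + c + q)! /
    ((c + q)! * (a + b + 2 * c + 2 * q + 1)!) else 0

theorem entry_symm (q a b c e : ℕ) : entry q a b c e = entry q b a e c := by
  unfold entry
  by_cases h : c = e
  · subst h
    rw [if_pos rfl, if_pos rfl, add_comm a b]
    ring
  · rw [if_neg h, if_neg (Ne.symm h)]

/-- Effect of a new site `(↑, ↑)`: a partner `(↑, ↑)` gets `2 - 1` from `2 · swap - 1`, a partner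
`(↓, ↓)` gets `-1`, and mixed partners get `0`. -/
theorem entry_up (q a b c e : ℕ) : entry q (a + 1) b c e =
    entry q a b c e + a * entry (q + 1) (a - 1) b c e - b * entry (q + 1) a (b - 1) c e := by
  unfold entry
  by_cases h : c = e
  · subst h
    simp only [if_true]
    -- The truncated `a - 1` is harmless, since the factor `a` kills the term at `a = 0`; the same
    -- holds for `b`.
    have h1 : (a : ℂ) * (2 ^ (q + 1 + (a - 1 + b + 2 * c)) * c ! * (a - 1 + c + (q + 1))! *
        (b + c + (q + 1))! / ((c + (q + 1))! * (a - 1 + b + 2 * c + 2 * (q + 1) + 1)!)) =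
        a * (2 ^ (q + (a + b + 2 * c)) * c ! * (a + c + q)! *
        (b + c + (q + 1))! / ((c + (q + 1))! * (a + b + 2 * c + 2 * q + 2)!)) := by
      cases a with
      | zero => simp
      | succ a =>
        rw [show q + 1 + (a + 1 - 1 + b + 2 * c) = q + (a + 1 + b + 2 * c) by omega,
          show a + 1 - 1 + c + (q + 1) = a + 1 + c + q by omega,
          show a + 1 - 1 + b + 2 * c + 2 * (q + 1) + 1 = a + 1 + b + 2 * c + 2 * q + 2 by omega]
    have h2 : (b : ℂ) * (2 ^ (q + 1 + (a + (b - 1) + 2 * c)) * c ! * (a + c + (q + 1))! *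
        (b - 1 + c + (q + 1))! / ((c + (q + 1))! * (a + (b - 1) + 2 * c + 2 * (q + 1) + 1)!)) =
        b * (2 ^ (q + (a + b + 2 * c)) * c ! * (a + c + (q + 1))! *
        (b + c + q)! / ((c + (q + 1))! * (a + b + 2 * c + 2 * q + 2)!)) := by
      cases b with
      | zero => simp
      | succ b =>
        rw [show q + 1 + (a + (b + 1 - 1) + 2 * c) = q + (a + (b + 1) + 2 * c) by omega,
          show b + 1 - 1 + c + (q + 1) = b + 1 + c + q by omega,
          show a + (b + 1 - 1) + 2 * c + 2 * (q + 1) + 1 = a + (b + 1) + 2 * c + 2 * q + 2 by omega]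
    rw [h1, h2, show a + 1 + b + 2 * c + 2 * q + 1 = (a + b + 2 * c + 2 * q + 1) + 1 by omega,
      show a + 1 + c + q = (a + c + q) + 1 by omega,
      show q + (a + 1 + b + 2 * c) = (q + (a + b + 2 * c)) + 1 by omega]
    simp only [← add_assoc, Nat.factorial_succ, pow_succ]
    have f1 : ((c + q)! : ℂ) ≠ 0 := by exact_mod_cast Nat.factorial_ne_zero _
    have f2 : ((a + b + 2 * c + 2 * q)! : ℂ) ≠ 0 := by exact_mod_cast Nat.factorial_ne_zero _
    have f3 : ((a : ℂ) + b + 2 * c + 2 * q + 1) ≠ 0 := by norm_cast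
    have f4 : ((a : ℂ) + b + 2 * c + 2 * q + 1 + 1) ≠ 0 := by norm_cast
    have f5 : ((c : ℂ) + q + 1) ≠ 0 := by norm_cast
    push_cast
    field_simp
    ring
  · simp [h]

theorem entry_down (q a b c e : ℕ) : entry q a (b + 1) c e =
    entry q a b c e - a * entry (q + 1) (a - 1) b c e + b * entry (q + 1) a (b - 1) c e := by
  rw [entry_symm, entry_up, entry_symm q b, entry_symm (q + 1) (b - 1), entry_symm (q + 1) b]
  ring

/-- A new site `(↑, ↓)` must be matched, and only the swap with a partner `(↓, ↑)` contributes, with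
weight `2`. -/
theorem entry_up_down (q a b c e : ℕ) :
    entry q a b (c + 1) e = 2 * e * entry (q + 1) a b c (e - 1) := by
  unfold entry
  cases e with
  | zero => simp
  | succ e =>
    by_cases h : c = e
    · subst h
      simp only [if_true, Nat.add_sub_cancel]
      rw [show a + b + 2 * (c + 1) + 2 * q + 1 = a + b + 2 * c + 2 * (q + 1) + 1 by omega,
        show q + (a + b + 2 * (c + 1)) = (q + 1 + (a + b + 2 * c)) + 1 by omega,
        show c + 1 + q = c + (q + 1) by omega, show a + (c + 1) + q = a + c + (q + 1) by omega,
        show b + (c + 1) + q = b + c + (q + 1) by omega, pow_succ, Nat.factorial_succ c]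
      push_cast
      ring
    · simp [h]

theorem entry_down_up (q a b c e : ℕ) :
    entry q a b c (e + 1) = 2 * c * entry (q + 1) a b (c - 1) e := by
  rw [entry_symm, entry_up_down, entry_symm (q + 1)]

/-- `∑_{r < N} 4ʳ / (2r+2q+1)!! (Mᵣ)_T`. -/
noncomputable def matchingSum (q N : ℕ) (T : Finset (Fin m)) : MT m :=
  ∑ r ∈ Finset.range N, ((4 : ℂ) ^ r / ((2 * r + 2 * q + 1)‼ : ℂ)) • matchingOp T r

/-- Using one pair shifts `r` by one, which the double factorial `(2r+2q+1)!!` absorbs as a shift of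
`q`; this is why the family carries the parameter `q`. -/
theorem matchingSum_insert {T : Finset (Fin m)} {j : Fin m} (hj : j ∉ T) (q N : ℕ) :
    matchingSum q (N + 1) (insert j T) = matchingSum q (N + 1) T +
      ∑ i ∈ T, (4 : ℂ) • (heis s(i, j) * matchingSum (q + 1) N (T.erase i)) := by
  simp only [matchingSum, Finset.sum_range_succ', matchingOp_insert hj, matchingOp_zero,
    smul_add, Finset.sum_add_distrib, Finset.smul_sum, Finset.mul_sum, Matrix.mul_smul, smul_smul]
  rw [add_right_comm, Finset.sum_comm]
  refine congrArg₂ _ rfl (Finset.sum_congr rfl fun i _ => Finset.sum_congr rfl fun r _ => ?_)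
  refine congrArg (· • _) ?_
  rw [show 2 * (r + 1) + 2 * q + 1 = 2 * r + 2 * (q + 1) + 1 by ring, pow_succ]
  ring

theorem entry_zero (q : ℕ) : entry q 0 0 0 0 = 1 / ((2 * q + 1)‼ : ℂ) := by
  have h1 : (2 * q + 1)! = (2 * q + 1)‼ * (2 ^ q * q !) := by
    rw [Nat.factorial_eq_mul_doubleFactorial, Nat.doubleFactorial_two_mul]
  have h2 : ((2 * q + 1)‼ : ℂ) ≠ 0 := by exact_mod_cast (Nat.doubleFactorial_pos _).ne'
  have h3 : (q ! : ℂ) ≠ 0 := by exact_mod_cast Nat.factorial_ne_zero _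
  simp only [entry, if_true, zero_add, add_zero, mul_zero]
  rw [h1]
  push_cast
  field_simp
  simp

theorem matchingSum_empty (q N : ℕ) :
    matchingSum q (N + 1) (∅ : Finset (Fin m)) = (1 / ((2 * q + 1)‼ : ℂ)) • 1 := by
  simp [matchingSum, Finset.sum_range_succ', matchingOp_zero, matchingOp_empty_succ]

theorem fin_two_cases (x : Fin 2) : x = 0 ∨ x = 1 := by omega

/-- The bound on `T.card` ensures that no matching is cut off by `r < N`. The parameters `q` and `N`
stay general in the induction because removing a pair changes both. -/
theorem matchingSum_apply (T : Finset (Fin m)) : ∀ (q N : ℕ), T.card < 2 * N →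
    ∀ s t : Fin m → Fin 2, matchingSum q N T s t = if ∀ k, k ∉ T → s k = t k then
      entry q (cnt T s t 0 0) (cnt T s t 1 1) (cnt T s t 0 1) (cnt T s t 1 0) else 0 := by
  induction T using Finset.strongInduction with
  | H T ih =>
  rcases T.eq_empty_or_nonempty with rfl | ⟨j, hjT⟩
  · intro q N hN s t
    obtain ⟨N, rfl⟩ : ∃ N', N = N' + 1 := ⟨N - 1, by simp at hN; omega⟩
    rw [matchingSum_empty]
    simp [cnt, entry_zero, Matrix.one_apply, funext_iff]
  · obtain ⟨T', hj, rfl⟩ : ∃ T', j ∉ T' ∧ insert j T' = T :=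
      ⟨T.erase j, Finset.notMem_erase _ _, Finset.insert_erase hjT⟩
    clear hjT
    intro q N hN s t
    rw [Finset.card_insert_of_notMem hj] at hN
    obtain ⟨N, rfl⟩ : ∃ N', N = N' + 1 := ⟨N - 1, by omega⟩
    -- The two indicators are the swap and the identity part of `4 𝐒ᵢ·𝐒ⱼ`; what remains lives on
    -- `T'.erase i`.
    have hi : ∀ i ∈ T', ((4 : ℂ) • (heis s(i, j) * matchingSum (q + 1) N (T'.erase i))) s t =
        if ∀ k, k ∉ insert j T' → s k = t k then
          (2 * (if s j = t i ∧ s i = t j then 1 else 0) - (if s i = t i ∧ s j = t j then 1 else 0))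
           * entry (q + 1) (cnt (T'.erase i) s t 0 0) (cnt (T'.erase i) s t 1 1)
              (cnt (T'.erase i) s t 0 1) (cnt (T'.erase i) s t 1 0) else 0 := by
      intro i hi
      have hij : i ≠ j := by rintro rfl; exact hj hi
      have hc := Finset.card_erase_add_one hi
      rw [Matrix.smul_apply, smul_eq_mul, heis_mul_apply hij]
      have hss : T'.erase i ⊂ insert j T' :=
        (Finset.erase_ssubset hi).trans (Finset.ssubset_insert hj)
      rw [ih _ hss _ _ (by omega), ih _ hss _ _ (by omega)]
      have hcg : ∀ x y, cnt (T'.erase i) (s ∘ Equiv.swap i j) t x y =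
          cnt (T'.erase i) s t x y := by
        refine fun x y => cnt_congr (fun k hk => ?_) x y
        rw [Function.comp_apply, Equiv.swap_apply_of_ne_of_ne (Finset.ne_of_mem_erase hk)]
        rintro rfl
        exact hj (Finset.mem_of_mem_erase hk)
      simp only [hcg]
      have e1 : (∀ k, k ∉ T'.erase i → s k = t k) ↔
          (∀ k, k ∉ insert j T' → s k = t k) ∧ s i = t i ∧ s j = t j := by
        constructor
        · intro h
          exact ⟨fun k hk => h k (by simp at hk ⊢; tauto), h i (by simp), h j (by simp [hj])⟩
        · rintro ⟨h, h1, h2⟩ k hk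
          by_cases hki : k = i
          · rw [hki, h1]
          · by_cases hkj : k = j
            · rw [hkj, h2]
            · exact h k (by simp at hk ⊢; tauto)
      have e2 : (∀ k, k ∉ T'.erase i → (s ∘ Equiv.swap i j) k = t k) ↔
          (∀ k, k ∉ insert j T' → s k = t k) ∧ s j = t i ∧ s i = t j := by
        constructor
        · intro h
          refine ⟨fun k hk => ?_, by simpa using h i (by simp), by simpa using h j (by simp [hj])⟩
          simp only [Finset.mem_insert, not_or] at hk
          have := h k (by simp; tauto)
          rwa [Function.comp_apply, Equiv.swap_apply_of_ne_of_ne _ hk.1] at this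
          rintro rfl
          exact hk.2 hi
        · rintro ⟨h, h1, h2⟩ k hk
          by_cases hki : k = i
          · subst hki; simpa using h1
          · by_cases hkj : k = j
            · subst hkj; simpa using h2
            · rw [Function.comp_apply, Equiv.swap_apply_of_ne_of_ne hki hkj]
              exact h k (by simp at hk ⊢; tauto)
      simp only [e1, e2]
      by_cases h0 : ∀ k, k ∉ insert j T' → s k = t k
      · simp only [and_iff_right h0, if_pos h0]
        split_ifs <;> ring
      · simp only [h0, false_and, if_false]
        ring
    rw [matchingSum_insert hj, Matrix.add_apply, Matrix.sum_apply, Finset.sum_congr rfl hi,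
      ih _ (Finset.ssubset_insert hj) _ _ (by omega)]
    have e3 : (∀ k, k ∉ T' → s k = t k) ↔
        (∀ k, k ∉ insert j T' → s k = t k) ∧ s j = t j := by
      constructor
      · exact fun h => ⟨fun k hk => h k (by simp at hk ⊢; tauto), h j hj⟩
      · rintro ⟨h, h1⟩ k hk
        by_cases hkj : k = j
        · rw [hkj, h1]
        · exact h k (by simp; tauto)
    rw [if_congr e3 rfl rfl]
    by_cases h0 : ∀ k, k ∉ insert j T' → s k = t k
    swap
    · simp only [h0, false_and, if_false, Finset.sum_const_zero, add_zero]
    simp only [and_iff_right h0, if_pos h0, cnt_insert hj]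
    -- The four types of the site `j` correspond to the four recursions for `entry`.
    rcases fin_two_cases (s j) with hs | hs <;> rcases fin_two_cases (t j) with ht | ht <;>
      simp only [hs, ht]
    · simp only [zero_ne_one, and_true, and_false, if_true, if_false, add_zero, and_self]
      rw [entry_up, add_sub_assoc]
      congr 1
      rw [← sum_ite_cnt, ← sum_ite_cnt, ← Finset.sum_sub_distrib]
      refine Finset.sum_congr rfl fun i hi => ?_
      simp only [cnt_erase hi]
      rcases fin_two_cases (s i) with h1 | h1 <;> rcases fin_two_cases (t i) with h2 | h2 <;>
        simp [h1, h2]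
      ring
    · simp only [zero_ne_one, one_ne_zero, and_true, and_false, if_true, if_false, add_zero,
        and_self, zero_add]
      rw [entry_up_down, mul_comm (2 : ℂ), mul_assoc, ← sum_ite_cnt]
      refine Finset.sum_congr rfl fun i hi => ?_
      simp only [cnt_erase hi]
      rcases fin_two_cases (s i) with h1 | h1 <;> rcases fin_two_cases (t i) with h2 | h2 <;>
        simp [h1, h2]
    · simp only [zero_ne_one, one_ne_zero, and_true, and_false, if_true, if_false, add_zero,
        and_self, zero_add]
      rw [entry_down_up, mul_comm (2 : ℂ), mul_assoc, ← sum_ite_cnt]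
      refine Finset.sum_congr rfl fun i hi => ?_
      simp only [cnt_erase hi]
      rcases fin_two_cases (s i) with h1 | h1 <;> rcases fin_two_cases (t i) with h2 | h2 <;>
        simp [h1, h2]
    · simp only [one_ne_zero, and_true, and_false, if_true, if_false, add_zero, and_self]
      rw [entry_down, sub_add_eq_add_sub, add_sub_assoc]
      congr 1
      rw [← sum_ite_cnt, ← sum_ite_cnt, ← Finset.sum_sub_distrib]
      refine Finset.sum_congr rfl fun i hi => ?_
      simp only [cnt_erase hi]
      rcases fin_two_cases (s i) with h1 | h1 <;> rcases fin_two_cases (t i) with h2 | h2 <;>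
        simp [h1, h2]
      ring

end Entries

/-! ## Pauli strings -/

section PauliStrings

variable {m : ℕ}

/-- The tensor product of the elements of `1, σ^X, σ^Y, σ^Z` with the given labels. -/
def pauliString (l : Fin m → Option (Fin 3)) : MT m := pureTensor fun i => basisB (l i)

/-- The span of the Pauli strings with labels in `P`. -/
def stringSpan (P : Set (Fin m → Option (Fin 3))) : Submodule ℂ (MT m) :=
  Submodule.span ℂ (pauliString '' P)

theorem stringSpan_mono {P Q : Set (Fin m → Option (Fin 3))} (h : P ⊆ Q) :
    stringSpan P ≤ stringSpan Q :=
  Submodule.span_mono (Set.image_mono h)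

theorem map_mem_stringSpan {P Q : Set (Fin m → Option (Fin 3))} (f : MT m →ₗ[ℂ] MT m)
    (h : ∀ l ∈ P, f (pauliString l) ∈ stringSpan Q) {X : MT m} (hX : X ∈ stringSpan P) :
    f X ∈ stringSpan Q := by
  have : stringSpan P ≤ (stringSpan Q).comap f := by
    rw [stringSpan, Submodule.span_le]
    rintro _ ⟨l, hl, rfl⟩
    exact h l hl
  exact this hX

/-- The parities of the numbers of occurrences of `σ^X, σ^Y, σ^Z` in a Pauli string. -/
def parity (l : Fin m → Option (Fin 3)) (U : Fin 3) : ZMod 2 :=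
  ((Finset.univ.filter fun i => l i = some U).card : ZMod 2)

/-- The labels of the Pauli strings with exactly `k` factors different from `1`, all at sites in
`T`, and with given parities. -/
def gradedLabels (T : Finset (Fin m)) (k : ℕ) (χ : Fin 3 → ZMod 2) :
    Set (Fin m → Option (Fin 3)) :=
  {l | (∀ i, i ∉ T → l i = none) ∧ (Finset.univ.filter fun i => l i ≠ none).card = k ∧
    parity l = χ}

theorem pureTensor_smul (c : Fin m → ℂ) (A : Fin m → M2) :
    (pureTensor fun i => c i • A i) = (∏ i, c i) • pureTensor A := by
  ext s t
  simp [pureTensor, Finset.prod_mul_distrib]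

theorem siteOp_mul_pauliString {j : Fin m} {l : Fin m → Option (Fin 3)} (hl : l j = none)
    (U : Fin 3) : siteOp j (spin U) * pauliString l =
      (1 / 2 : ℂ) • pauliString (Function.update l j (some U)) := by
  have h := pureTensor_smul (fun i => if i = j then (1 / 2 : ℂ) else 1)
    (fun i => basisB (Function.update l j (some U) i))
  rw [Finset.prod_ite_eq' Finset.univ j, if_pos (Finset.mem_univ j)] at h
  rw [siteOp, pauliString, pureTensor_mul, pauliString, ← h]
  congr 1
  funext i
  by_cases hi : i = j
  · subst hi
    simp [hl, basisB, spin]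
  · simp [hi]

theorem update_mem_gradedLabels {T : Finset (Fin m)} {k : ℕ} {χ : Fin 3 → ZMod 2} {j : Fin m}
    (hj : j ∉ T) {l : Fin m → Option (Fin 3)} (hl : l ∈ gradedLabels T k χ) (U : Fin 3) :
    Function.update l j (some U) ∈ gradedLabels (insert j T) (k + 1) (χ + Pi.single U 1) := by
  obtain ⟨h1, h2, h3⟩ := hl
  have hlj := h1 j hj
  refine ⟨fun i hi => ?_, ?_, ?_⟩
  · rw [Finset.mem_insert, not_or] at hi
    rw [Function.update_of_ne hi.1, h1 i hi.2]
  · have : (Finset.univ.filter fun i => Function.update l j (some U) i ≠ none) =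
        insert j (Finset.univ.filter fun i => l i ≠ none) := by
      ext i
      by_cases hi : i = j
      · subst hi; simp
      · simp [hi]
    rw [this, Finset.card_insert_of_notMem (by simp [hlj]), h2]
  · rw [← h3]
    funext V
    rw [Pi.add_apply, parity, parity]
    by_cases hUV : V = U
    · subst hUV
      have : (Finset.univ.filter fun i => Function.update l j (some V) i = some V) =
          insert j (Finset.univ.filter fun i => l i = some V) := by
        ext i
        by_cases hi : i = j
        · subst hi; simp
        · simp [hi]
      rw [this, Finset.card_insert_of_notMem (by simp [hlj])]
      simp
    · rw [Pi.single_eq_of_ne hUV, add_zero]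
      congr 2
      ext i
      by_cases hi : i = j
      · subst hi; simp [hlj, Ne.symm hUV]
      · simp [hi]

/-- The strings carry `1` at `j ∉ T`, so no two Pauli matrices are multiplied at one site and the
degree goes up by exactly one. -/
theorem siteOp_mul_mem {T : Finset (Fin m)} {k : ℕ} {χ : Fin 3 → ZMod 2} {j : Fin m}
    (hj : j ∉ T) (U : Fin 3) {X : MT m} (hX : X ∈ stringSpan (gradedLabels T k χ)) :
    siteOp j (spin U) * X ∈
      stringSpan (gradedLabels (insert j T) (k + 1) (χ + Pi.single U 1)) := by
  refine map_mem_stringSpan (LinearMap.mulLeft ℂ (siteOp j (spin U))) (fun l hl => ?_) hX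
  rw [LinearMap.mulLeft_apply, siteOp_mul_pauliString (hl.1 j hj)]
  exact Submodule.smul_mem _ _
    (Submodule.subset_span ⟨_, update_mem_gradedLabels hj hl U, rfl⟩)

theorem heis_mul_mem {T : Finset (Fin m)} {k : ℕ} {χ : Fin 3 → ZMod 2} {i j : Fin m}
    (hij : i ≠ j) (hi : i ∉ T) (hj : j ∉ T) {X : MT m}
    (hX : X ∈ stringSpan (gradedLabels T k χ)) :
    heis s(i, j) * X ∈ stringSpan (gradedLabels (insert i (insert j T)) (k + 2) χ) := by
  change (∑ U : Fin 3, siteOp i (spin U) * siteOp j (spin U)) * X ∈ _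
  rw [Finset.sum_mul]
  refine Submodule.sum_mem _ fun U _ => ?_
  rw [Matrix.mul_assoc]
  have h := siteOp_mul_mem (j := i) (by simp [hij, hi]) U (siteOp_mul_mem hj U hX)
  -- The same `U` occurs at both sites, so the parities are unchanged.
  rwa [add_assoc χ, ← Pi.single_add, CharTwo.add_self_eq_zero, Pi.single_zero, add_zero] at h

theorem gradedLabels_mono {S T : Finset (Fin m)} (h : S ⊆ T) (k : ℕ) (χ : Fin 3 → ZMod 2) :
    gradedLabels S k χ ⊆ gradedLabels T k χ :=
  fun _ hl => ⟨fun i hi => hl.1 i fun hS => hi (h hS), hl.2⟩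

theorem one_mem_stringSpan (T : Finset (Fin m)) :
    (1 : MT m) ∈ stringSpan (gradedLabels T 0 0) := by
  refine Submodule.subset_span ⟨fun _ => none, ⟨fun _ _ => rfl, by simp, ?_⟩, ?_⟩
  · funext U
    simp [parity]
  · ext s t
    simp [pauliString, pureTensor, basisB, Matrix.one_apply, Finset.prod_boole, funext_iff]

/-- The degree `2r` gives the eigenvalue under the transfer operator, the even parities give
orthogonality. -/
theorem matchingOp_mem (T : Finset (Fin m)) :
    ∀ r, matchingOp T r ∈ stringSpan (gradedLabels T (2 * r) 0) := by
  induction T using Finset.strongInduction with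
  | H T ih =>
  rintro (_ | r)
  · rw [matchingOp_zero]
    exact one_mem_stringSpan T
  rcases T.eq_empty_or_nonempty with rfl | ⟨j, hjT⟩
  · rw [matchingOp_empty_succ]
    exact Submodule.zero_mem _
  obtain ⟨T', hj, rfl⟩ : ∃ T', j ∉ T' ∧ insert j T' = T :=
    ⟨T.erase j, Finset.notMem_erase _ _, Finset.insert_erase hjT⟩
  rw [matchingOp_insert hj]
  refine Submodule.add_mem _ ?_ (Submodule.sum_mem _ fun i hi => ?_)
  · exact stringSpan_mono (gradedLabels_mono (Finset.subset_insert _ _) _ _)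
      (ih _ (Finset.ssubset_insert hj) _)
  · have hss : T'.erase i ⊂ insert j T' :=
      (Finset.erase_ssubset hi).trans (Finset.ssubset_insert hj)
    have h := heis_mul_mem (i := i) (j := j) (by rintro rfl; exact hj hi)
      (Finset.notMem_erase i T') (fun h => hj (Finset.mem_of_mem_erase h)) (ih _ hss r)
    rwa [Finset.insert_comm, Finset.insert_erase hi] at h

/-! ### The action of the transfer operator -/

theorem transferE_basisB (A : Option (Fin 3)) :
    transferE (basisB A) = (if A = none then (1 : ℂ) else -1 / 3) • basisB A := by
  have hU : ∀ U, (spin U)ᴴ = spin U := by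
    intro U
    ext a b
    fin_cases U <;> fin_cases a <;> fin_cases b <;> simp [spin, pauli]
  have hin : ∀ X Y : M2, inner ℂ X Y = (Xᴴ * Y).trace := fun _ _ => rfl
  simp only [transferE, ketbra, LinearMap.sub_apply, LinearMap.smul_apply, LinearMap.sum_apply,
    LinearMap.smulRight_apply, innerₛₗ_apply_apply, hin, hU]
  ext a b
  rcases A with _ | U
  · fin_cases a <;> fin_cases b <;>
      simp [Fin.sum_univ_succ, basisB, spin, pauli, Matrix.trace]
  · fin_cases U <;> fin_cases a <;> fin_cases b <;>
      simp [Fin.sum_univ_succ, basisB, spin, pauli, Matrix.trace, Matrix.mul_apply] <;>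
      ring_nf

theorem tensorPower_pureTensor (T : M2 →ₗ[ℂ] M2) (A : Fin m → M2) :
    tensorPower T m (pureTensor A) = pureTensor fun i => T (A i) := by
  have hT : ∀ (X : M2) (x y : Fin 2),
      T X x y = ∑ a, ∑ b, X a b * T (Matrix.single a b 1) x y := by
    intro X x y
    conv_lhs => rw [Matrix.matrix_eq_sum_single X]
    simp only [map_sum, Matrix.sum_apply]
    refine Finset.sum_congr rfl fun a _ => Finset.sum_congr rfl fun b _ => ?_
    rw [show Matrix.single a b (X a b) = X a b • Matrix.single a b (1 : ℂ) by simp, map_smul,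
      Matrix.smul_apply, smul_eq_mul]
  ext x y
  simp only [tensorPower, LinearMap.sum_apply, LinearMap.smulRight_apply, Matrix.sum_apply,
    Matrix.smul_apply, smul_eq_mul, pureTensor, Matrix.of_apply, Matrix.entryLinearMap_apply]
  simp only [hT (A _)]
  rw [Finset.prod_univ_sum, Fintype.piFinset_univ]
  refine Finset.sum_congr rfl fun s _ => ?_
  rw [Finset.prod_univ_sum, Fintype.piFinset_univ]
  refine Finset.sum_congr rfl fun t _ => ?_
  rw [Finset.prod_mul_distrib]

theorem tensorPower_transferE_of_mem {T : Finset (Fin m)} {k : ℕ} {χ : Fin 3 → ZMod 2}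
    {X : MT m} (hX : X ∈ stringSpan (gradedLabels T k χ)) :
    tensorPower transferE m X = (-1 / 3 : ℂ) ^ k • X := by
  have : stringSpan (gradedLabels T k χ) ≤
      LinearMap.eqLocus (tensorPower transferE m) ((-1 / 3 : ℂ) ^ k • LinearMap.id) := by
    rw [stringSpan, Submodule.span_le]
    rintro _ ⟨l, hl, rfl⟩
    change tensorPower transferE m (pauliString l) = (-1 / 3 : ℂ) ^ k • pauliString l
    rw [pauliString, tensorPower_pureTensor]
    simp only [transferE_basisB]
    rw [pureTensor_smul, ← hl.2.1, Finset.prod_ite, Finset.prod_const_one, one_mul,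
      Finset.prod_const]
  exact this hX

theorem pow_apply_of_eq_smul {E : Type*} [AddCommGroup E] [Module ℂ E] {f : E →ₗ[ℂ] E} {c : ℂ}
    {x : E} (h : f x = c • x) (n : ℕ) : (f ^ n) x = c ^ n • x := by
  induction n with
  | zero => simp
  | succ n ih => rw [pow_succ, Module.End.mul_apply, h, map_smul, ih, smul_smul, pow_succ']

/-- The degree of each term equals its exponent of `β`, so the eigenvalue `(-1/3)^{2rn}` is absorbed
into `β`. -/
theorem pow_tensorPower_Vrho (n : ℕ) (β : ℂ) :
    (tensorPower transferE m ^ n) (Vrho m β) = Vrho m (β * (-1 / 3 : ℂ) ^ n) := by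
  rw [Vrho, Vrho, map_sum]
  refine Finset.sum_congr rfl fun r _ => ?_
  rw [map_smul, pow_apply_of_eq_smul (tensorPower_transferE_of_mem (matchingOp_mem _ r)),
    smul_smul]
  congr 1
  ring

theorem siteOp_mul_matchingOp_mem (j : Fin m) (U : Fin 3) (r : ℕ) :
    siteOp j (spin U) * matchingOp (Finset.univ.erase j) r ∈
      stringSpan (gradedLabels Finset.univ (2 * r + 1) (Pi.single U 1)) := by
  have h := siteOp_mul_mem (Finset.notMem_erase j Finset.univ) U (matchingOp_mem _ r)
  rwa [Finset.insert_erase (Finset.mem_univ j), zero_add] at h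

theorem pow_tensorPower_Vspin (n : ℕ) (U : Fin 3) (β : ℂ) :
    (tensorPower transferE m ^ n) (Vspin m U β) = Vspin m U (β * (-1 / 3 : ℂ) ^ n) := by
  rw [Vspin, Vspin, map_neg, map_sum]
  simp only [map_sum]
  refine congrArg _ (Finset.sum_congr rfl fun r _ => Finset.sum_congr rfl fun j _ => ?_)
  rw [map_smul,
    pow_apply_of_eq_smul (tensorPower_transferE_of_mem (siteOp_mul_matchingOp_mem j U r)),
    smul_smul]
  congr 1
  ring

theorem pow_tensorPower_Vop (n : ℕ) (A : Option (Fin 3)) (β : ℂ) :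
    (tensorPower transferE m ^ n) (Vop m A β) = Vop m A (β * (-1 / 3 : ℂ) ^ n) := by
  rcases A with _ | U
  · exact pow_tensorPower_Vrho n β
  · exact pow_tensorPower_Vspin n U β

/-! ### Orthogonality -/

theorem inner_basisB (A B : Option (Fin 3)) :
    inner ℂ (basisB A) (basisB B) = if A = B then (2 : ℂ) else 0 := by
  change ((basisB A)ᴴ * basisB B).trace = _
  rcases A with _ | U <;> rcases B with _ | V
  · simp [basisB]
  · fin_cases V <;> simp [basisB, pauli, Matrix.trace, Fin.sum_univ_succ]
  · fin_cases U <;> simp [basisB, pauli, Matrix.trace, Fin.sum_univ_succ]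
  · fin_cases U <;> fin_cases V <;>
      simp [basisB, pauli, Matrix.trace, Fin.sum_univ_succ, Matrix.mul_apply] <;> norm_num

theorem inner_pureTensor (A B : Fin m → M2) :
    inner ℂ (pureTensor A) (pureTensor B) = ∏ i, inner ℂ (A i) (B i) := by
  change ((pureTensor A)ᴴ * pureTensor B).trace = ∏ i, ((A i)ᴴ * B i).trace
  have h : (pureTensor A)ᴴ = pureTensor fun i => (A i)ᴴ := by
    ext s t
    simp [pureTensor, Matrix.conjTranspose_apply]
  rw [h, pureTensor_mul]
  simp only [Matrix.trace, Matrix.diag_apply, pureTensor, Matrix.of_apply]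
  rw [Finset.prod_univ_sum, Fintype.piFinset_univ]

theorem inner_pauliString {l l' : Fin m → Option (Fin 3)} (h : l ≠ l') :
    inner ℂ (pauliString l) (pauliString l') = 0 := by
  obtain ⟨i, hi⟩ := Function.ne_iff.1 h
  rw [pauliString, pauliString, inner_pureTensor]
  exact Finset.prod_eq_zero (Finset.mem_univ i) (by rw [inner_basisB, if_neg hi])

theorem stringSpan_isOrtho {P Q : Set (Fin m → Option (Fin 3))} (h : Disjoint P Q) :
    stringSpan P ⟂ stringSpan Q := by
  rw [stringSpan, stringSpan, Submodule.isOrtho_span]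
  rintro _ ⟨l, hl, rfl⟩ _ ⟨l', hl', rfl⟩
  exact inner_pauliString (by rintro rfl; exact Set.disjoint_left.1 h hl hl')

/-- The parities of the Pauli strings in `V_{A/2}`. -/
def parityOf : Option (Fin 3) → Fin 3 → ZMod 2
  | none => 0
  | some U => Pi.single U 1

theorem parityOf_injective : Function.Injective parityOf := by
  have h : ∀ U : Fin 3, (Pi.single U 1 : Fin 3 → ZMod 2) ≠ 0 := fun U h => by
    have := congrFun h U
    simp at this
  rintro (_ | U) (_ | V) hAB
  · rfl
  · exact absurd hAB.symm (h V)
  · exact absurd hAB (h U)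
  · by_contra hne
    have := congrFun hAB U
    have hUV : U ≠ V := fun h => hne (by rw [h])
    simp [parityOf, Pi.single_eq_of_ne hUV] at this

theorem Vop_mem (A : Option (Fin 3)) (β : ℂ) :
    Vop m A β ∈ stringSpan {l | parity l = parityOf A} := by
  have hsub : ∀ k χ, stringSpan (gradedLabels (Finset.univ : Finset (Fin m)) k χ) ≤
      stringSpan {l | parity l = χ} := fun k χ => stringSpan_mono fun l hl => hl.2.2
  rcases A with _ | U
  · rw [Vop, Vrho]
    exact Submodule.sum_mem _ fun r _ => Submodule.smul_mem _ _ (hsub _ _ (matchingOp_mem _ r))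
  · rw [Vop, Vspin]
    exact Submodule.neg_mem _ (Submodule.sum_mem _ fun r _ => Submodule.sum_mem _ fun j _ =>
      Submodule.smul_mem _ _ (hsub _ _ (siteOp_mul_matchingOp_mem j U r)))

/-- Different parity vectors mean that the two operators have no Pauli string in common, and
distinct strings are orthogonal. -/
theorem inner_Vop {A B : Option (Fin 3)} (h : A ≠ B) (β : ℂ) :
    inner ℂ (Vop m A β) (Vop m B β) = 0 := by
  refine Submodule.isOrtho_iff_inner_eq.1 (stringSpan_isOrtho ?_) _ (Vop_mem A β) _ (Vop_mem B β)
  rw [Set.disjoint_left]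
  intro l hA hB
  exact h (parityOf_injective (hA.symm.trans hB))

end PauliStrings

end AKLT

/-- If a linear map sends an orthonormal basis to an orthogonal family, then its singular values
are the norms of the images of the basis vectors. -/
theorem LinearMap.singularValues_eq_of_orthogonal {𝕜 E F ι : Type*} [RCLike 𝕜]
    [NormedAddCommGroup E] [InnerProductSpace 𝕜 E] [FiniteDimensional 𝕜 E]
    [NormedAddCommGroup F] [InnerProductSpace 𝕜 F] [FiniteDimensional 𝕜 F] [Fintype ι]
    (T : E →ₗ[𝕜] F) (b : OrthonormalBasis ι 𝕜 E)
    (hb : ∀ i j, i ≠ j → inner 𝕜 (T (b i)) (T (b j)) = 0) :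
    (Multiset.range (Module.finrank 𝕜 E)).map T.singularValues =
      (Finset.univ : Finset ι).val.map fun i => ‖T (b i)‖ := by
  classical
  have hM : LinearMap.toMatrix b.toBasis b.toBasis (T.adjoint ∘ₗ T) =
      Matrix.diagonal fun i => ((‖T (b i)‖ ^ 2 : ℝ) : 𝕜) := by
    ext i j
    rw [LinearMap.toMatrix_apply, b.coe_toBasis_repr_apply, b.coe_toBasis, b.repr_apply_apply,
      LinearMap.comp_apply, LinearMap.adjoint_inner_right, Matrix.diagonal_apply]
    split_ifs with h
    · subst h
      rw [inner_self_eq_norm_sq_to_K]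
      push_cast
      rfl
    · exact hb i j h
  -- `T* T` is diagonal in `b`, so its eigenvalues with multiplicity are the roots `‖T (b i)‖²` of
  -- its characteristic polynomial; square roots give the singular values.
  have hr := T.isSymmetric_adjoint_comp_self.roots_charpoly_eq_eigenvalues rfl
  rw [← LinearMap.charpoly_toMatrix _ b.toBasis, hM, Matrix.charpoly_diagonal,
    Polynomial.roots_prod _ _ (by
      rw [Finset.prod_ne_zero_iff]
      exact fun i _ => Polynomial.X_sub_C_ne_zero _)] at hr
  simp only [Polynomial.roots_X_sub_C, Multiset.bind_singleton] at hr
  have hr' := congrArg (Multiset.map fun z : 𝕜 => √(RCLike.re z)) hr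
  simp only [Multiset.map_map, Function.comp_def, RCLike.ofReal_re,
    Real.sqrt_sq (norm_nonneg _)] at hr'
  rw [hr']
  have hrange : ∀ n, Multiset.range n = (Finset.univ : Finset (Fin n)).val.map Fin.val := by
    intro n
    rw [Fin.univ_val_map, List.ofFn_eq_map, List.map_coe_finRange_eq_range]
    rfl
  rw [hrange, Multiset.map_map]
  refine Multiset.map_congr rfl fun i _ => ?_
  rw [Function.comp_apply, T.singularValues_fin rfl]

namespace AKLT

/-! ### The normalized Pauli basis of `M₂(ℂ)` -/

theorem inv_sqrt_two_smul_basisB_orthonormal :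
    Orthonormal ℂ fun A => (((√2)⁻¹ : ℝ) : ℂ) • basisB A := by
  rw [orthonormal_iff_ite]
  intro A B
  rw [inner_smul_left, inner_smul_right, inner_basisB, Complex.conj_ofReal]
  split_ifs
  · have h : (((√2)⁻¹ * ((√2)⁻¹ * 2) : ℝ) : ℂ) = 1 := by
      rw [← mul_assoc, ← mul_inv, Real.mul_self_sqrt (by norm_num)]
      norm_num
    exact_mod_cast h
  · simp

theorem exists_orthonormalBasis_basisB : ∃ b : OrthonormalBasis (Option (Fin 3)) ℂ M2,
    ∀ A, b A = (((√2)⁻¹ : ℝ) : ℂ) • basisB A := by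
  have hcard : Fintype.card (Option (Fin 3)) = Module.finrank ℂ M2 := by
    rw [Module.finrank_matrix]
    simp
  have hon := inv_sqrt_two_smul_basisB_orthonormal
  refine ⟨OrthonormalBasis.mk hon ?_, fun A => by rw [OrthonormalBasis.coe_mk]⟩
  rw [hon.linearIndependent.span_eq_top_of_card_eq_finrank' hcard]

/-! ## The undecorated transfer operator -/

section Transfer

variable {m : ℕ}

/-- The number of up spins. -/
def numUp (s : Fin m → Fin 2) : ℕ := (Finset.univ.filter fun i => s i = 0).card

theorem numUp_le (s : Fin m → Fin 2) : numUp s ≤ m :=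
  (Finset.card_filter_le _ _).trans (by simp)

theorem numUp_eq_left (s t : Fin m → Fin 2) :
    numUp s = cnt Finset.univ s t 0 0 + cnt Finset.univ s t 0 1 := by
  rw [numUp, cnt, cnt, ← Finset.card_filter_add_card_filter_not (fun i => t i = 0),
    Finset.filter_filter, Finset.filter_filter]
  have h : ∀ x : Fin 2, ¬x = 0 ↔ x = 1 := by decide
  simp only [h]

theorem cnt_swap (T : Finset (Fin m)) (s t : Fin m → Fin 2) (x y : Fin 2) :
    cnt T s t x y = cnt T t s y x := by
  simp only [cnt, and_comm]

theorem numUp_eq_right (s t : Fin m → Fin 2) :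
    numUp t = cnt Finset.univ s t 0 0 + cnt Finset.univ s t 1 0 := by
  rw [numUp_eq_left t s, cnt_swap _ t s, cnt_swap _ t s]

theorem sum_cnt (s t : Fin m → Fin 2) :
    cnt Finset.univ s t 0 0 + cnt Finset.univ s t 1 1 + cnt Finset.univ s t 0 1 +
      cnt Finset.univ s t 1 0 = m := by
  have h : ∀ i ∈ (Finset.univ : Finset (Fin m)),
      ((if s i = 0 ∧ t i = 0 then 1 else 0) + (if s i = 1 ∧ t i = 1 then 1 else 0) +
        (if s i = 0 ∧ t i = 1 then 1 else 0) + (if s i = 1 ∧ t i = 0 then 1 else 0)) = 1 := by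
    intro i _
    rcases fin_two_cases (s i) with h1 | h1 <;> rcases fin_two_cases (t i) with h2 | h2 <;>
      simp [h1, h2]
  have h' := Finset.sum_congr rfl h
  simpa only [cnt, Finset.sum_add_distrib, ← Finset.card_filter, Finset.sum_const, Finset.card_univ,
    Fintype.card_fin, smul_eq_mul, mul_one] using h'

theorem sqrt_div_mul {x y p q : ℝ} (hy : 0 < y) (hp : 0 < p) (hq : 0 < q)
    (h : x * q = y * p) : √(x / y) * (1 / √p) = 1 / √q := by
  have hx : x = y * p / q := by field_simp; linarith
  rw [one_div, one_div, ← Real.sqrt_inv, ← Real.sqrt_inv, ← Real.sqrt_mul (by rw [hx]; positivity)]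
  congr 1
  rw [hx]
  field_simp

/-- The prefactor turns the normalization on `m` sites into the one on `m + 1` sites, by `(m+1-k)
(m+1 choose k) = (m+1) (m choose k)`. -/
theorem tensorV_down (k : ℕ) (s : Fin m → Fin 2) :
    tensorV (m + 1) k 1 s =
      if numUp s = k then ((1 / √((m + 1).choose k : ℝ) : ℝ) : ℂ) else 0 := by
  have e : tensorV (m + 1) k 1 s =
      ((√((((m + 1 : ℕ) : ℝ) - k) / ((m + 1 : ℕ) : ℝ)) : ℝ) : ℂ) * star (symVec m k s) := by
    simp [tensorV, Matrix.vecMulVec_apply]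
  rw [e, symVec]
  change _ * star (if numUp s = k then _ else _) = _
  split_ifs with h
  · have hk : k ≤ m := h ▸ numUp_le s
    rw [Complex.star_def, Complex.conj_ofReal, ← Complex.ofReal_mul, sqrt_div_mul]
    · positivity
    · exact_mod_cast Nat.choose_pos hk
    · exact_mod_cast Nat.choose_pos (by omega)
    · have := Nat.choose_mul_succ_eq m k
      rw [← Nat.cast_sub (by omega)]
      norm_cast
      linarith
  · simp

theorem tensorV_up (k : ℕ) (s : Fin m → Fin 2) :
    tensorV (m + 1) k 0 s =
      if numUp s + 1 = k then ((1 / √((m + 1).choose k : ℝ) : ℝ) : ℂ) else 0 := by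
  have e : tensorV (m + 1) k 0 s =
      ((√((k : ℝ) / ((m + 1 : ℕ) : ℝ)) : ℝ) : ℂ) * star (symVec m (k - 1) s) := by
    simp [tensorV, Matrix.vecMulVec_apply]
  rw [e]
  -- For `k = 0` the index `k - 1` truncates to `0`, but the coefficient vanishes.
  rcases k with _ | k
  · simp
  rw [symVec, Nat.add_sub_cancel]
  change _ * star (if numUp s = k then _ else _) = _
  simp only [Nat.add_right_cancel_iff]
  split_ifs with h
  · have hk : k ≤ m := h ▸ numUp_le s
    rw [Complex.star_def, Complex.conj_ofReal, ← Complex.ofReal_mul, sqrt_div_mul]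
    · positivity
    · exact_mod_cast Nat.choose_pos hk
    · exact_mod_cast Nat.choose_pos (by omega)
    · have := Nat.add_one_mul_choose_eq m k
      norm_cast
      linarith
  · simp

theorem sum_ite_choose (x y : ℕ) (hx : x ≤ m + 1) :
    ∑ k ∈ Finset.range (m + 2),
      (if x = k then ((1 / √((m + 1).choose k : ℝ) : ℝ) : ℂ) else 0) *
        (if y = k then ((1 / √((m + 1).choose k : ℝ) : ℝ) : ℂ) else 0) =
      if x = y then 1 / ((m + 1).choose x : ℂ) else 0 := by
  rw [Finset.sum_eq_single x]
  · rw [if_pos rfl]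
    by_cases h : x = y
    · subst h
      rw [if_pos rfl, if_pos rfl, ← Complex.ofReal_mul, div_mul_div_comm,
        Real.mul_self_sqrt (by positivity)]
      simp
    · rw [if_neg (Ne.symm h), if_neg h, mul_zero]
  · intro k _ hk
    rw [if_neg (Ne.symm hk), zero_mul]
  · intro h
    exact absurd (Finset.mem_range.2 (by omega)) h

/-- Each row of `V_k` is supported on a single number of up spins, so in every product of two rows
at most one `k` survives the sum. -/
theorem transferL0_apply (B : M2) (s t : Fin m → Fin 2) :
    transferL0 (m + 1) B s t =
      B 1 1 * (if numUp s = numUp t then 1 / ((m + 1).choose (numUp s + 1) : ℂ) else 0) +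
      B 0 0 * (if numUp s = numUp t then 1 / ((m + 1).choose (numUp s) : ℂ) else 0) -
      B 1 0 * (if numUp s + 1 = numUp t then 1 / ((m + 1).choose (numUp s + 1) : ℂ) else 0) -
      B 0 1 * (if numUp s = numUp t + 1 then 1 / ((m + 1).choose (numUp s) : ℂ) else 0) := by
  have hs := numUp_le s
  have h1 := sum_ite_choose (m := m) (numUp s + 1) (numUp t + 1) (by omega)
  have h2 := sum_ite_choose (m := m) (numUp s) (numUp t) (by omega)
  have h3 := sum_ite_choose (m := m) (numUp s + 1) (numUp t) (by omega)
  have h4 := sum_ite_choose (m := m) (numUp s) (numUp t + 1) (by omega)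
  simp only [Nat.add_right_cancel_iff] at h1
  have hstar : ∀ k (s : Fin m → Fin 2) a, star (tensorV (m + 1) k a s) = tensorV (m + 1) k a s := by
    intro k s a
    rcases fin_two_cases a with rfl | rfl
    · rw [tensorV_up]
      split_ifs
      · rw [Complex.star_def, Complex.conj_ofReal]
      · simp
    · rw [tensorV_down]
      split_ifs
      · rw [Complex.star_def, Complex.conj_ofReal]
      · simp
  have hW : ∀ k ∈ Finset.range (m + 2), ((tensorW (m + 1) k)ᴴ * B * tensorW (m + 1) k) s t =
      B 1 1 * (tensorV (m + 1) k 0 s * tensorV (m + 1) k 0 t) +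
      B 0 0 * (tensorV (m + 1) k 1 s * tensorV (m + 1) k 1 t) -
      B 1 0 * (tensorV (m + 1) k 0 s * tensorV (m + 1) k 1 t) -
      B 0 1 * (tensorV (m + 1) k 1 s * tensorV (m + 1) k 0 t) := by
    intro k _
    -- `K` exchanges the rows of `V_k`, with a sign in the lower one.
    have w0 : ∀ s, tensorW (m + 1) k 0 s = tensorV (m + 1) k 1 s := fun s => by
      simp [tensorW, singletK, Matrix.mul_apply]
    have w1 : ∀ s, tensorW (m + 1) k 1 s = -tensorV (m + 1) k 0 s := fun s => by
      simp [tensorW, singletK, Matrix.mul_apply]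
    generalize tensorW (m + 1) k = W at *
    have : (Wᴴ * B * W) s t = ∑ b, (∑ a, star (W a s) * B a b) * W b t := by
      simp only [Matrix.mul_apply, Matrix.conjTranspose_apply]
    rw [this]
    simp only [Fin.sum_univ_two]
    erw [w0 s, w0 t, w1 s, w1 t]
    rw [star_neg, hstar, hstar]
    ring
  change (∑ k ∈ Finset.range (m + 1 + 1), (tensorW (m + 1) k)ᴴ * B * tensorW (m + 1) k) s t = _
  rw [Matrix.sum_apply]
  erw [Finset.sum_congr rfl hW]
  simp only [Finset.sum_sub_distrib, Finset.sum_add_distrib, ← Finset.mul_sum, tensorV_up,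
    tensorV_down, h1, h2, h3, h4]

theorem entry_zero_left (a b c e : ℕ) : entry 0 a b c e = if c = e then
    2 ^ (a + b + c + e) / (((a + b + c + e : ℕ) + 1) * ((a + b + c + e).choose (a + c) : ℂ))
      else 0 := by
  rw [entry]
  split_ifs with h
  · subst h
    have h1 := Nat.cast_add_choose ℂ (a := a + c) (b := b + c)
    rw [show a + b + c + c = (a + c) + (b + c) by ring, h1,
      show 0 + (a + b + 2 * c) = (a + c) + (b + c) by ring,
      show a + b + 2 * c + 2 * 0 + 1 = (a + c) + (b + c) + 1 by ring, Nat.factorial_succ]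
    simp only [add_zero]
    have f1 : ((a + c)! : ℂ) ≠ 0 := by exact_mod_cast Nat.factorial_ne_zero _
    have f2 : ((b + c)! : ℂ) ≠ 0 := by exact_mod_cast Nat.factorial_ne_zero _
    have f3 : ((a + c + (b + c))! : ℂ) ≠ 0 := by exact_mod_cast Nat.factorial_ne_zero _
    have f4 : (c ! : ℂ) ≠ 0 := by exact_mod_cast Nat.factorial_ne_zero _
    have f5 : (((a + c + (b + c) : ℕ) : ℂ) + 1) ≠ 0 := by norm_cast
    push_cast at f5 ⊢
    field_simp
  · rfl

/-- For `B = 1` the two diagonal contributions add up to this sum; the factor `m + 2 = d + 1` of the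
result comes from here. -/
theorem inv_choose_add_inv_choose {u : ℕ} (hu : u ≤ m) :
    1 / ((m + 1).choose u : ℂ) + 1 / ((m + 1).choose (u + 1) : ℂ) =
      (m + 2) / ((m + 1) * (m.choose u : ℂ)) := by
  obtain ⟨v, rfl⟩ := Nat.exists_eq_add_of_le hu
  have h0 := Nat.cast_add_choose ℂ (a := u) (b := v)
  have h1 := Nat.cast_add_choose ℂ (a := u) (b := v + 1)
  have h2 := Nat.cast_add_choose ℂ (a := u + 1) (b := v)
  rw [show u + 1 + v = u + v + 1 by ring] at h2
  rw [← add_assoc] at h1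
  rw [h0, h1, h2, Nat.factorial_succ, Nat.factorial_succ, Nat.factorial_succ]
  have f1 : (u ! : ℂ) ≠ 0 := by exact_mod_cast Nat.factorial_ne_zero _
  have f2 : (v ! : ℂ) ≠ 0 := by exact_mod_cast Nat.factorial_ne_zero _
  have f3 : ((u + v)! : ℂ) ≠ 0 := by exact_mod_cast Nat.factorial_ne_zero _
  have f4 : ((u : ℂ) + v + 1) ≠ 0 := by norm_cast
  have f5 : (u : ℂ) + 1 ≠ 0 := by norm_cast
  have f6 : (v : ℂ) + 1 ≠ 0 := by norm_cast
  push_cast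
  field_simp
  ring

theorem Vrho_two_eq : Vrho m 2 = matchingSum 0 (m / 2 + 1) Finset.univ := by
  rw [Vrho, matchingSum]
  refine Finset.sum_congr rfl fun r _ => ?_
  rw [pow_mul]
  norm_num

theorem transferL0_one :
    transferL0 (m + 1) 1 = (((m : ℂ) + 2) / 2 ^ m) • Vrho m 2 := by
  refine Matrix.ext fun (s t : Fin m → Fin 2) => ?_
  rw [transferL0_apply, Matrix.smul_apply, Vrho_two_eq, matchingSum_apply _ _ _ (by simp; omega)]
  simp only [Finset.mem_univ, not_true_eq_false, false_implies, implies_true, if_true,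
    entry_zero_left, sum_cnt, ← numUp_eq_left]
  have e : (cnt Finset.univ s t 0 1 = cnt Finset.univ s t 1 0) ↔ numUp s = numUp t := by
    rw [numUp_eq_left s t, numUp_eq_right s t]
    omega
  have h2 : (2 : ℂ) ^ m ≠ 0 := pow_ne_zero _ two_ne_zero
  simp only [e]
  by_cases h : numUp s = numUp t
  · have := inv_choose_add_inv_choose (numUp_le s)
    simp only [if_pos h, Matrix.one_apply_eq, one_mul, ne_eq, zero_ne_one, one_ne_zero,
      not_false_eq_true, Matrix.one_apply_ne, zero_mul, sub_zero, smul_eq_mul]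
    rw [add_comm, this]
    field_simp
  · simp [h]

/-- The denominators `(2r+3)!!` are the case `q = 1`, and `2^{2r+1} = 2 · 4ʳ` leaves a factor `2`,
which later turns `S^U` into `σ^U`. -/
theorem Vspin_two_eq (U : Fin 3) : Vspin m U 2 = -∑ j : Fin m,
    (2 : ℂ) • (siteOp j (spin U) * matchingSum 1 ((m - 1) / 2 + 1) (Finset.univ.erase j)) := by
  rw [Vspin, Finset.sum_comm]
  refine congrArg _ (Finset.sum_congr rfl fun j _ => ?_)
  rw [matchingSum, Finset.mul_sum, Finset.smul_sum]
  refine Finset.sum_congr rfl fun r _ => ?_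
  rw [Matrix.mul_smul, smul_smul, pow_succ, pow_mul]
  congr 1
  rw [show 2 * r + 2 * 1 + 1 = 2 * r + 3 by ring]
  norm_num
  ring

theorem Vspin_two_apply (U : Fin 3) (s t : Fin m → Fin 2) : Vspin m U 2 s t =
    -∑ j : Fin m, pauli U (s j) (t j) *
      entry 1 (cnt (Finset.univ.erase j) s t 0 0) (cnt (Finset.univ.erase j) s t 1 1)
        (cnt (Finset.univ.erase j) s t 0 1) (cnt (Finset.univ.erase j) s t 1 0) := by
  rw [Vspin_two_eq, Matrix.neg_apply, Matrix.sum_apply]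
  refine congrArg _ (Finset.sum_congr rfl fun j _ => ?_)
  have hc : (Finset.univ.erase j : Finset (Fin m)).card < 2 * ((m - 1) / 2 + 1) := by
    rw [Finset.card_erase_of_mem (Finset.mem_univ j), Finset.card_univ, Fintype.card_fin]
    have := j.pos
    omega
  rw [Matrix.smul_apply, siteOp_mul_apply, Finset.sum_eq_single (t j)]
  · rw [matchingSum_apply _ _ _ hc, if_pos]
    · have hcg : ∀ x y, cnt (Finset.univ.erase j) (Function.update s j (t j)) t x y =
          cnt (Finset.univ.erase j) s t x y := cnt_congr fun k hk => by
        rw [Function.update_of_ne (Finset.ne_of_mem_erase hk)]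
      simp only [hcg, spin, Matrix.smul_apply, smul_eq_mul]
      ring
    · intro k hk
      obtain rfl : k = j := by simpa using hk
      simp
  · intro a _ ha
    rw [matchingSum_apply _ _ _ hc, if_neg, mul_zero]
    intro h
    exact ha (by simpa using h j (by simp))
  · simp

/-- Summing over `j` by the type of `(s j, t j)` produces the right-hand sides of the recursions for
`entry` at `q = 0`. Read backwards, these express the sum through entries for `m + 1` and `m` sites,
hence through reciprocals of binomial coefficients. -/
theorem transferL0_pauli (U : Fin 3) :
    transferL0 (m + 1) (pauli U) = (((m : ℂ) + 2) / 2 ^ m) • Vspin m U 2 := by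
  have htr : pauli U 1 1 = -pauli U 0 0 := by
    fin_cases U <;> simp [pauli]
  refine Matrix.ext fun (s t : Fin m → Fin 2) => ?_
  rw [transferL0_apply, Matrix.smul_apply, Vspin_two_apply U, htr]
  have hsum := sum_cnt s t
  have hs := numUp_eq_left s t
  have ht := numUp_eq_right s t
  have hle := numUp_le s
  have key : ∀ j ∈ (Finset.univ : Finset (Fin m)), pauli U (s j) (t j) *
      entry 1 (cnt (Finset.univ.erase j) s t 0 0) (cnt (Finset.univ.erase j) s t 1 1)
        (cnt (Finset.univ.erase j) s t 0 1) (cnt (Finset.univ.erase j) s t 1 0) =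
      (if s j = 0 ∧ t j = 0 then pauli U 0 0 * entry 1 (cnt Finset.univ s t 0 0 - 1)
        (cnt Finset.univ s t 1 1) (cnt Finset.univ s t 0 1) (cnt Finset.univ s t 1 0) else 0) +
      (if s j = 1 ∧ t j = 1 then -pauli U 0 0 * entry 1 (cnt Finset.univ s t 0 0)
        (cnt Finset.univ s t 1 1 - 1) (cnt Finset.univ s t 0 1) (cnt Finset.univ s t 1 0) else 0) +
      (if s j = 0 ∧ t j = 1 then pauli U 0 1 * entry 1 (cnt Finset.univ s t 0 0)
        (cnt Finset.univ s t 1 1) (cnt Finset.univ s t 0 1 - 1) (cnt Finset.univ s t 1 0) else 0) +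
      (if s j = 1 ∧ t j = 0 then pauli U 1 0 * entry 1 (cnt Finset.univ s t 0 0)
        (cnt Finset.univ s t 1 1) (cnt Finset.univ s t 0 1) (cnt Finset.univ s t 1 0 - 1)
          else 0) := by
    intro j hj
    simp only [cnt_erase hj]
    rcases fin_two_cases (s j) with h1 | h1 <;> rcases fin_two_cases (t j) with h2 | h2 <;>
      simp [h1, h2, htr]
  rw [Finset.sum_congr rfl key]
  simp only [Finset.sum_add_distrib, sum_ite_cnt]
  generalize cnt Finset.univ s t 0 0 = a at *
  generalize cnt Finset.univ s t 1 1 = b at *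
  generalize cnt Finset.univ s t 0 1 = c at *
  generalize cnt Finset.univ s t 1 0 = e at *
  have r1 := entry_up 0 a b c e
  have r2 := entry_up_down 0 a b c e
  have r3 := entry_down_up 0 a b c e
  rw [zero_add] at r1 r2 r3
  have i1 := inv_choose_add_inv_choose hle
  have h2 : (2 : ℂ) ^ m ≠ 0 := pow_ne_zero _ two_ne_zero
  have h3 : (m : ℂ) + 2 ≠ 0 := by norm_cast
  have h4 : (m : ℂ) + 1 ≠ 0 := by norm_cast
  have c1 : ((m.choose (numUp s) : ℕ) : ℂ) ≠ 0 := by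
    exact_mod_cast (Nat.choose_pos hle).ne'
  rw [entry_zero_left, entry_zero_left] at r1
  rw [entry_zero_left] at r2 r3
  rw [show a + 1 + b + c + e = m + 1 by omega, hsum, show a + 1 + c = numUp s + 1 by omega,
    ← hs] at r1
  rw [show a + b + (c + 1) + e = m + 1 by omega, show a + (c + 1) = numUp s + 1 by omega] at r2
  rw [show a + b + c + (e + 1) = m + 1 by omega, ← hs] at r3
  have q1 : (numUp s = numUp t) ↔ c = e := by omega
  have q2 : (numUp s + 1 = numUp t) ↔ c + 1 = e := by omega
  have q3 : (numUp s = numUp t + 1) ↔ c = e + 1 := by omega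
  simp only [q1, q2, q3]
  have total : (a : ℂ) * (pauli U 0 0 * entry 1 (a - 1) b c e) +
      b * (-pauli U 0 0 * entry 1 a (b - 1) c e) + c * (pauli U 0 1 * entry 1 a b (c - 1) e) +
      e * (pauli U 1 0 * entry 1 a b c (e - 1)) =
      pauli U 0 0 * (a * entry 1 (a - 1) b c e - b * entry 1 a (b - 1) c e) +
      pauli U 0 1 * (2 * c * entry 1 a b (c - 1) e) / 2 +
      pauli U 1 0 * (2 * e * entry 1 a b c (e - 1)) / 2 := by ring
  -- The diagonal part becomes the difference of the `q = 0` entries for `m + 1` and `m` sites; each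
  -- off-diagonal part is half an entry for `m + 1` sites.
  rw [total, ← r2, ← r3, ← sub_eq_iff_eq_add'.2 (r1.trans (add_sub_assoc _ _ _)), smul_eq_mul]
  have p1 : (((m + 1 : ℕ) : ℂ) + 1) = m + 2 := by push_cast; ring
  rw [p1]
  generalize pauli U 0 0 = x
  generalize pauli U 0 1 = y
  generalize pauli U 1 0 = z
  by_cases hce : c = e
  · subst hce
    simp only [if_true, Nat.succ_ne_self, (Nat.succ_ne_self c).symm, if_false]
    have i2 : 1 / ((m + 1).choose (numUp s) : ℂ) =
      (m + 2) / ((m + 1) * (m.choose (numUp s) : ℂ)) - 1 / ((m + 1).choose (numUp s + 1) : ℂ) :=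
      eq_sub_of_add_eq i1
    have c2 : (((m + 1).choose (numUp s + 1) : ℕ) : ℂ) ≠ 0 := by
      exact_mod_cast (Nat.choose_pos (by omega)).ne'
    rw [i2]
    field_simp
    ring
  · simp only [hce, if_false]
    have hpow : (2 : ℂ) ^ (m + 1) = 2 * 2 ^ m := by ring
    rw [hpow]
    have i3 : ∀ w : ℂ, (m + 2 : ℂ) / 2 ^ m * ((2 * 2 ^ m / ((m + 2) * w)) / 2) = 1 / w := by
      intro w
      by_cases hw : w = 0
      · simp [hw]
      · field_simp
    split_ifs
    · omega
    · rw [← i3]; ring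
    · rw [← i3]; ring
    · ring

theorem transferL0_basisB (A : Option (Fin 3)) :
    transferL0 (m + 1) (basisB A) = (((m : ℂ) + 2) / 2 ^ m) • Vop m A 2 := by
  rcases A with _ | U
  · exact transferL0_one
  · exact transferL0_pauli U

theorem transferL_basisB (n : ℕ) (A : Option (Fin 3)) :
    transferL (m + 1) n (basisB A) =
      (((m : ℂ) + 2) / 2 ^ m) • Vop m A (2 * (-1 / 3 : ℂ) ^ n) := by
  rw [transferL, LinearMap.comp_apply, transferL0_basisB, map_smul]
  exact congrArg _ (pow_tensorPower_Vop n A 2)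

end Transfer

end AKLT

/-! ### Assembly of the lemma -/

theorem mainTheorem4 (d n : ℕ) (hd : 3 ≤ d) (α : ℂ) (hα : α = 2 * (-1 / 3 : ℂ) ^ n) :
    (∀ A : Option (Fin 3), AKLT.transferL d n (AKLT.basisB A) =
      (((d : ℂ) + 1) / 2 ^ (d - 1)) • AKLT.Vop (d - 1) A α) ∧
    (∀ A B : Option (Fin 3), A ≠ B →
      inner ℂ (AKLT.Vop (d - 1) A α) (AKLT.Vop (d - 1) B α) = 0) ∧
    (Multiset.range (Module.finrank ℂ AKLT.M2)).map (AKLT.transferL d n).singularValues =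
      (Finset.univ : Finset (Option (Fin 3))).val.map fun A =>
        ((d : ℝ) + 1) / (2 : ℝ) ^ ((d : ℝ) - 1 / 2) * ‖AKLT.Vop (d - 1) A α‖ := by
  obtain ⟨m, rfl⟩ : ∃ m, d = m + 1 := ⟨d - 1, by omega⟩
  have h1 : ∀ A : Option (Fin 3), AKLT.transferL (m + 1) n (AKLT.basisB A) =
      ((((m + 1 : ℕ) : ℂ) + 1) / 2 ^ m) • AKLT.Vop m A α := by
    intro A
    rw [AKLT.transferL_basisB, hα]
    congr 2
    push_cast
    ring
  refine ⟨h1, fun A B hAB => AKLT.inner_Vop hAB α, ?_⟩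
  obtain ⟨b, hb⟩ := AKLT.exists_orthonormalBasis_basisB
  have hT : ∀ A, AKLT.transferL (m + 1) n (b A) =
      (((√2)⁻¹ : ℝ) : ℂ) • ((((m + 1 : ℕ) : ℂ) + 1) / 2 ^ m) • AKLT.Vop m A α := fun A => by
    rw [hb, map_smul, h1]
  rw [LinearMap.singularValues_eq_of_orthogonal _ b fun A B hAB => by
    rw [hT, hT]
    simp only [inner_smul_left, inner_smul_right]
    erw [AKLT.inner_Vop hAB α]
    simp]
  refine Multiset.map_congr rfl fun A _ => ?_
  rw [hT]
  have hc : ∀ X : AKLT.MT m,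
      ‖(((√2)⁻¹ : ℝ) : ℂ) • ((((m + 1 : ℕ) : ℂ) + 1) / 2 ^ m) • X‖ =
      (((m + 1 : ℕ) : ℝ) + 1) / (2 : ℝ) ^ (((m + 1 : ℕ) : ℝ) - 1 / 2) * ‖X‖ := by
    intro X
    rw [norm_smul, norm_smul, ← mul_assoc]
    congr 1
    have e1 : ‖(((m + 1 : ℕ) : ℂ) + 1) / 2 ^ m‖ = (((m + 1 : ℕ) : ℝ) + 1) / 2 ^ m := by
      rw [norm_div, norm_pow, ← Nat.cast_succ, Complex.norm_natCast]
      simp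
    -- The extra `√2` is the norm of each `A` in the basis `1, σ^X, σ^Y, σ^Z`.
    have e2 : (2 : ℝ) ^ (((m + 1 : ℕ) : ℝ) - 1 / 2) = 2 ^ m * √2 := by
      rw [show ((m + 1 : ℕ) : ℝ) - 1 / 2 = (m : ℝ) + 1 / 2 by push_cast; ring,
        Real.rpow_add (by norm_num), Real.rpow_natCast, Real.sqrt_eq_rpow]
    rw [e1, e2, Complex.norm_real, Real.norm_of_nonneg (by positivity)]
    field_simp
  exact hc _
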